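/- Let $n\ge 1$, let $\mathscr C$ be an additive category, $\Sigma$ an automorphism of $\mathscr C$, and $\square$ a class of $(n+2)$-$\Sigma$-sequences $X^0\xrightarrow{d^0}X^1\to\cdots\xrightarrow{d^n}X^{n+1}\to\Sigma X^0$ making $(\mathscr C,\Sigma,\square)$ an $(n+2)$-angulated category in the sense of Geiss--Keller--Oppermann. That is, the members of $\square$ (the $(n+2)$-angles) satisfy: (F1) $\square$ is closed under direct sums and direct summands, contains $A\xrightarrow{1}A\to0\to\cdots\to0\to\Sigma A$ for all $A$, and every morphism is the first morphism of some $(n+2)$-angle; (F2) a sequence is in $\square$ if and only if its left rotation, with last morphism $(-1)^n\Sigma d^0$, is; (F3) every commutative square between the first morphisms of two $(n+2)$-angles extends to a morphism $\varphi$ of $(n+2)$-$\Sigma$-sequences; (F4) in (F3), $\varphi$ can be chosen so that its mapping cone is in $\square$. For $A,C\in\mathscr C$ let $\mathbf C^{n+2}_{(A,C)}$ be the category of complexes $X^\bullet\colon X^0\to X^1\to\cdots\to X^n\to X^{n+1}$ in $\mathscr C$ with $X^0=A$ and $X^{n+1}=C$, whose morphisms are the morphisms of complexes that are the identity on $X^0$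 and $X^{n+1}$; let $[X^\bullet]$ be the homotopy equivalence class of $X^\bullet$ in $\mathbf C^{n+2}_{(A,C)}$. Let $\mathbb E_\Sigma=\mathscr C(-,\Sigma-)\colon\mathscr C^{\mathrm{op}}\times\mathscr C\to\mathrm{Ab}$, and write $a_*\delta=(\Sigma a)\circ\delta$, $c^*\delta=\delta\circ c$ for $\delta\in\mathbb E_\Sigma(C,A)=\mathscr C(C,\Sigma A)$. Then every $\delta\in\mathbb E_\Sigma(C,A)$ can be completed to an $(n+2)$-angle $A\to X^1\to\cdots\to X^n\to C\xrightarrow{\delta}\Sigma A$; the class $\mathfrak s_\square(\delta)=[A\to X^1\to\cdots\to X^n\to C]$ does not depend on the choice of this $(n+2)$-angle; and $\mathfrak s=\mathfrak s_\square$ is an exact realization of $\mathbb E=\mathbb E_\Sigma$ for which $(\mathscr C,\mathbb E_\Sigma,\mathfrak s_\square)$ is an $n$-exangulated category. Explicitly, $\mathbb E_\Sigma$ is a biadditive functor and the following hold. (R0) If $\mathfrak s(\delta)=[X^\bullet]$, $\mathfrak s(\rho)=[Y^\bullet]$ and $a_*\delta=c^*\rho$, then there is a morphism of complexes $X^\bullet\to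 Y^\bullet$ of the form $(a,f^1,\dots,f^n,c)$ (a lift of $(a,c)$). (R1) If $\mathfrak s(\delta)=[X^\bullet]$, then $\langle X^\bullet,\delta\rangle$ is an $n$-exangle: the sequences $\mathscr C(-,X^0)\to\cdots\to\mathscr C(-,X^{n+1})\xrightarrow{c\mapsto c^*\delta}\mathbb E(-,X^0)$ and $\mathscr C(X^{n+1},-)\to\cdots\to\mathscr C(X^0,-)\xrightarrow{a\mapsto a_*\delta}\mathbb E(X^{n+1},-)$ are exact. (It is then called distinguished, and $X^\bullet$ a conflation, $d_X^0$ an inflation, $d_X^n$ a deflation.) (R2) For every $A$, $\mathfrak s(0)=[A\xrightarrow{1}A\to0\to\cdots\to0]$ for $0\in\mathbb E(0,A)$, and $\mathfrak s(0)=[0\to\cdots\to0\to A\xrightarrow{1}A]$ for $0\in\mathbb E(A,0)$. (EA1) Inflations are closed under composition, and so are deflations. (EA2) If $\rho\in\mathbb E(D,A)$, $c\in\mathscr C(C,D)$, and $\langle X^\bullet,c^*\rho\rangle$, $\langle Y^\bullet,\rho\rangle$ are distinguished, then $(1_A,c)$ has a lift $f^\bullet\colon X^\bullet\to Y^\bullet$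 whose mapping cone $M_f\colon X^1\to X^2\oplus Y^1\to\cdots\to X^{n+1}\oplus Y^n\to Y^{n+1}$ (with differentials $\begin{bmatrix}-d_X^1\\ f^1\end{bmatrix}$, $\begin{bmatrix}-d_X^{i+1}&0\\ f^{i+1}&d_Y^i\end{bmatrix}$ for $1\le i\le n-1$, $\begin{bmatrix}f^{n+1}&d_Y^n\end{bmatrix}$) makes $\langle M_f,(d_X^0)_*\rho\rangle$ a distinguished $n$-exangle. (EA2$^{\mathrm{op}}$) Dually, if $\rho\in\mathbb E(C,A)$, $a\in\mathscr C(A,B)$, and $\langle X^\bullet,\rho\rangle$, $\langle Y^\bullet,a_*\rho\rangle$ are distinguished, then $(a,1_C)$ has a lift $h^\bullet\colon X^\bullet\to Y^\bullet$ whose mapping cocone $N_h\colon X^0\to X^1\oplus Y^0\to\cdots\to X^n\oplus Y^{n-1}\to Y^n$ (with differentials $\begin{bmatrix}d_X^0\\ h^0\end{bmatrix}$, $\begin{bmatrix}d_X^{i}&0\\ h^{i}&-d_Y^{i-1}\end{bmatrix}$ for $1\le i\le n-1$, $\begin{bmatrix}h^{n}&-d_Y^{n-1}\end{bmatrix}$)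 makes $\langle N_h,(d_Y^n)^*\rho\rangle$ a distinguished $n$-exangle. -/

import Mathlib

open CategoryTheory CategoryTheory.Limits Opposite
open scoped ZeroObject

universe w v u

namespace NExangulated

section Extensions

/-! ### Extensions for a bifunctor `E : Cᵒᵖ ⥤ C ⥤ Ab` -/

/-- `E` is biadditive: additive in each of its two variables. -/
def IsBiadditive {C : Type u} [Category.{v} C] [Preadditive C]
    (E : Cᵒᵖ ⥤ C ⥤ AddCommGrpCat.{w}) : Prop :=
  (∀ Z : Cᵒᵖ, (E.obj Z).Additive) ∧ (∀ A : C, (E.flip.obj A).Additive)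

/-- The group `E(Z, A)` of `E`-extensions with end terms `A` and `Z`. -/
abbrev Ext {C : Type u} [Category.{v} C]
    (E : Cᵒᵖ ⥤ C ⥤ AddCommGrpCat.{w}) (Z A : C) : Type w :=
  (E.obj (op Z)).obj A

/-- `a_* δ = E(Z, a)(δ)`. -/
def push {C : Type u} [Category.{v} C] {E : Cᵒᵖ ⥤ C ⥤ AddCommGrpCat.{w}}
    {Z A A' : C} (a : A ⟶ A') (δ : Ext E Z A) : Ext E Z A' :=
  (E.obj (op Z)).map a δ

/-- `c^* δ = E(c, A)(δ)`. -/
def pull {C : Type u} [Category.{v} C] {E : Cᵒᵖ ⥤ C ⥤ AddCommGrpCat.{w}}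
    {Z Z' A : C} (c : Z' ⟶ Z) (δ : Ext E Z A) : Ext E Z' A :=
  (E.map c.op).app A δ

end Extensions

section Complexes

/-! ### Complexes of length `n + 2` with fixed end terms, and their homotopy classes -/

/-- The objects of `C^{n+2}_{(A,Z)}`: complexes `X⁰ ⟶ X¹ ⟶ ⋯ ⟶ Xⁿ ⟶ Xⁿ⁺¹` (cochain complexes
vanishing outside the degrees `0, …, n+1`) with end terms `X⁰ = A` and `Xⁿ⁺¹ = Z`.
The end terms are identified with `A` and `Z` by specified isomorphisms instead of by
equalities of objects; morphisms are required to respect these identifications. Every such complex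
is isomorphic, by a morphism that is the identity on the end terms, to one for which both
identifications are identities. -/
structure EndedComplex {C : Type u} [Category.{v} C] [Preadditive C] (n : ℕ) (A Z : C) where
  /-- the underlying complex -/
  K : CochainComplex C ℕ
  isZero : ∀ i, n + 1 < i → IsZero (K.X i)
  /-- the identification `X⁰ = A` -/
  left : K.X 0 ≅ A
  /-- the identification `Xⁿ⁺¹ = Z` -/
  right : K.X (n + 1) ≅ Z

/-- The first differential `A ⟶ X¹`. -/
def EndedComplex.dFirst {C : Type u} [Category.{v} C] [Preadditive C] {n : ℕ} {A Z : C}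
    (X : EndedComplex n A Z) : A ⟶ X.K.X 1 :=
  X.left.inv ≫ X.K.d 0 1

/-- The last differential `Xⁿ ⟶ Z`. -/
def EndedComplex.dLast {C : Type u} [Category.{v} C] [Preadditive C] {n : ℕ} {A Z : C}
    (X : EndedComplex n A Z) : X.K.X n ⟶ Z :=
  X.K.d n (n + 1) ≫ X.right.hom

/-- The morphism of complexes `f` is of the form `(a, f¹, …, fⁿ, c)`. -/
def HasEnds {C : Type u} [Category.{v} C] [Preadditive C] {n : ℕ} {A Z A' Z' : C}
    {X : EndedComplex n A Z} {Y : EndedComplex n A' Z'} (f : X.K ⟶ Y.K)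
    (a : A ⟶ A') (c : Z ⟶ Z') : Prop :=
  f.f 0 ≫ Y.left.hom = X.left.hom ≫ a ∧ f.f (n + 1) ≫ Y.right.hom = X.right.hom ≫ c

/-- `X` and `Y` are homotopy equivalent in `C^{n+2}_{(A,Z)}`: there are mutually inverse homotopy
equivalences between them, both of which are the identity on the end terms. -/
def HtpyEquivalent {C : Type u} [Category.{v} C] [Preadditive C] {n : ℕ} {A Z : C}
    (X Y : EndedComplex n A Z) : Prop :=
  ∃ e : HomotopyEquiv X.K Y.K,
    HasEnds (X := X) (Y := Y) e.hom (𝟙 A) (𝟙 Z) ∧ HasEnds (X := Y) (Y := X) e.inv (𝟙 A) (𝟙 Z)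

theorem HasEnds.comp {C : Type u} [Category.{v} C] [Preadditive C] {n : ℕ}
    {A Z A' Z' A'' Z'' : C} {X : EndedComplex n A Z} {Y : EndedComplex n A' Z'}
    {W : EndedComplex n A'' Z''} {f : X.K ⟶ Y.K} {g : Y.K ⟶ W.K}
    {a : A ⟶ A'} {c : Z ⟶ Z'} {a' : A' ⟶ A''} {c' : Z' ⟶ Z''}
    (hf : HasEnds (X := X) (Y := Y) f a c) (hg : HasEnds (X := Y) (Y := W) g a' c') :
    HasEnds (X := X) (Y := W) (f ≫ g) (a ≫ a') (c ≫ c') := by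
  obtain ⟨h1, h2⟩ := hf
  obtain ⟨h3, h4⟩ := hg
  constructor
  · rw [HomologicalComplex.comp_f, Category.assoc, h3, ← Category.assoc, h1, Category.assoc]
  · rw [HomologicalComplex.comp_f, Category.assoc, h4, ← Category.assoc, h2, Category.assoc]

/-- Homotopy equivalence in `C^{n+2}_{(A,Z)}`. -/
def endedSetoid {C : Type u} [Category.{v} C] [Preadditive C] (n : ℕ) (A Z : C) :
    Setoid (EndedComplex n A Z) where
  r := HtpyEquivalent
  iseqv :=
    { refl := fun X => ⟨HomotopyEquiv.refl X.K, by constructor <;> simp [HasEnds]⟩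
      symm := fun ⟨e, h1, h2⟩ => ⟨e.symm, h2, h1⟩
      trans := fun ⟨e, h1, h2⟩ ⟨e', h1', h2'⟩ => ⟨e.trans e',
        by simpa using h1.comp h1', by simpa using h2'.comp h2⟩ }

/-- The set of homotopy equivalence classes of `C^{n+2}_{(A,Z)}`. -/
abbrev HtpyClass {C : Type u} [Category.{v} C] [Preadditive C] (n : ℕ) (A Z : C) :
    Type (max u v) :=
  Quotient (endedSetoid (C := C) n A Z)

/-- The class `[X]`. -/
def EndedComplex.cls {C : Type u} [Category.{v} C] [Preadditive C] {n : ℕ} {A Z : C}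
    (X : EndedComplex n A Z) : HtpyClass n A Z :=
  Quotient.mk (endedSetoid n A Z) X

/-- The complex `A = A ⟶ 0 ⟶ ⋯ ⟶ 0`, with identity in degrees `0, 1`. -/
noncomputable def trivLeft {C : Type u} [Category.{v} C] [Preadditive C] [HasZeroObject C]
    (n : ℕ) [NeZero n] (A : C) : EndedComplex n A (0 : C) where
  K := HomologicalComplex.double (c := ComplexShape.up ℕ) (i₀ := 0) (i₁ := 1) (𝟙 A) rfl
  isZero i hi := HomologicalComplex.isZero_double_X _ _ _ (by omega) (by omega)
  left := HomologicalComplex.doubleXIso₀ _ _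
  right := (HomologicalComplex.isZero_double_X _ _ _ (by omega)
    (by have := NeZero.pos n; omega)).iso (isZero_zero C)

/-- The complex `0 ⟶ ⋯ ⟶ 0 ⟶ A = A`, with identity in degrees `n, n + 1`. -/
noncomputable def trivRight {C : Type u} [Category.{v} C] [Preadditive C] [HasZeroObject C]
    (n : ℕ) [NeZero n] (A : C) : EndedComplex n (0 : C) A where
  K := HomologicalComplex.double (c := ComplexShape.up ℕ) (i₀ := n) (i₁ := n + 1) (𝟙 A) rfl
  isZero i hi := HomologicalComplex.isZero_double_X _ _ _ (by omega) (by omega)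
  left := (HomologicalComplex.isZero_double_X _ _ _ (NeZero.pos n).ne (by omega)).iso
    (isZero_zero C)
  right := HomologicalComplex.doubleXIso₁ _ _ (by omega)

end Complexes

section Exangles

/-! ### `n`-exangles, mapping cones and cocones -/

/-- `⟨X, δ⟩` is an `n`-exangle: for every object `Q` the sequences of abelian groups
`C(Q, X⁰) ⟶ ⋯ ⟶ C(Q, Xⁿ⁺¹) ⟶ E(Q, A)` and
`C(Xⁿ⁺¹, Q) ⟶ ⋯ ⟶ C(X⁰, Q) ⟶ E(Z, Q)` are exact. -/
structure IsNExangle {C : Type u} [Category.{v} C] [Preadditive C]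
    {E : Cᵒᵖ ⥤ C ⥤ AddCommGrpCat.{w}} {n : ℕ} {A Z : C}
    (X : EndedComplex n A Z) (δ : Ext E Z A) : Prop where
  exact_from : ∀ (Q : C) (i : ℕ), i < n →
    Function.Exact (fun g : Q ⟶ X.K.X i => g ≫ X.K.d i (i + 1))
      (fun g : Q ⟶ X.K.X (i + 1) => g ≫ X.K.d (i + 1) (i + 2))
  exact_from_last : ∀ Q : C,
    Function.Exact (fun g : Q ⟶ X.K.X n => g ≫ X.dLast) (fun c : Q ⟶ Z => pull c δ)
  exact_to : ∀ (Q : C) (i : ℕ), i < n →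
    Function.Exact (fun g : X.K.X (i + 2) ⟶ Q => X.K.d (i + 1) (i + 2) ≫ g)
      (fun g : X.K.X (i + 1) ⟶ Q => X.K.d i (i + 1) ≫ g)
  exact_to_last : ∀ Q : C,
    Function.Exact (fun g : X.K.X 1 ⟶ Q => X.dFirst ≫ g) (fun a : A ⟶ Q => push a δ)

/-- Data exhibiting `M` as the mapping cone
`X¹ ⟶ X² ⊞ Y¹ ⟶ ⋯ ⟶ Xⁿ⁺¹ ⊞ Yⁿ ⟶ Yⁿ⁺¹` of a morphism `f : X ⟶ Y` with `f⁰ = id`.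
In `Biprod.ofComponents p q r s : U₁ ⊞ U₂ ⟶ V₁ ⊞ V₂` one has `p : U₁ ⟶ V₁`, `q : U₁ ⟶ V₂`,
`r : U₂ ⟶ V₁` and `s : U₂ ⟶ V₂`. -/
structure ConeData {C : Type u} [Category.{v} C] [Preadditive C] [HasBinaryBiproducts C]
    {n : ℕ} [NeZero n] {A Z D : C} {X : EndedComplex n A Z} {Y : EndedComplex n A D}
    (f : X.K ⟶ Y.K) (M : EndedComplex n (X.K.X 1) D) where
  e : ∀ i, 1 ≤ i → i ≤ n → (M.K.X i ≅ X.K.X (i + 1) ⊞ Y.K.X i)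
  first : M.dFirst ≫ (e 1 le_rfl (NeZero.pos n)).hom = biprod.lift (-X.K.d 1 2) (f.f 1)
  middle : ∀ i (h1 : 1 ≤ i) (hn : i + 1 ≤ n),
    M.K.d i (i + 1) ≫ (e (i + 1) (by omega) hn).hom =
      (e i h1 (by omega)).hom ≫
        Biprod.ofComponents (-X.K.d (i + 1) (i + 2)) (f.f (i + 1)) 0 (Y.K.d i (i + 1))
  last : M.dLast = (e n (NeZero.pos n) le_rfl).hom ≫
    biprod.desc (f.f (n + 1) ≫ Y.right.hom) Y.dLast

/-- Data exhibiting `N` as the mapping cocone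
`X⁰ ⟶ X¹ ⊞ Y⁰ ⟶ ⋯ ⟶ Xⁿ ⊞ Yⁿ⁻¹ ⟶ Yⁿ` of a morphism `h : X ⟶ Y` with `hⁿ⁺¹ = id`
(the mapping cone of `h`, taken in the opposite category). -/
structure CoconeData {C : Type u} [Category.{v} C] [Preadditive C] [HasBinaryBiproducts C]
    {n : ℕ} [NeZero n] {A B Z : C} {X : EndedComplex n A Z} {Y : EndedComplex n B Z}
    (h : X.K ⟶ Y.K) (N : EndedComplex n A (Y.K.X n)) where
  e : ∀ i j, i + 1 = j → j ≤ n → (N.K.X j ≅ X.K.X j ⊞ Y.K.X i)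
  first : N.dFirst ≫ (e 0 1 rfl (NeZero.pos n)).hom =
    biprod.lift X.dFirst (X.left.inv ≫ h.f 0)
  middle : ∀ i j k (hij : i + 1 = j) (hjk : j + 1 = k) (hk : k ≤ n),
    N.K.d j k ≫ (e j k hjk hk).hom =
      (e i j hij (by omega)).hom ≫
        Biprod.ofComponents (X.K.d j k) (h.f j) 0 (-Y.K.d i j)
  last : ∀ i (hi : i + 1 = n),
    N.dLast = (e i n hi le_rfl).hom ≫ biprod.desc (h.f n) (-Y.K.d i n)

end Exangles

section Realizations

/-! ### Realizations and `n`-exangulated categories -/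

/-- A correspondence associating with each extension `δ ∈ E(Z, A)` a homotopy equivalence class in
`C^{n+2}_{(A,Z)}`. -/
abbrev Correspondence {C : Type u} [Category.{v} C] [Preadditive C]
    (E : Cᵒᵖ ⥤ C ⥤ AddCommGrpCat.{w}) (n : ℕ) : Type (max u v w) :=
  ∀ (Z A : C), Ext E Z A → HtpyClass n A Z

/-- `X` realizes `δ`, that is, `s(δ) = [X]`. -/
def Realizes {C : Type u} [Category.{v} C] [Preadditive C]
    {E : Cᵒᵖ ⥤ C ⥤ AddCommGrpCat.{w}} {n : ℕ} (s : Correspondence E n) {A Z : C}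
    (X : EndedComplex n A Z) (δ : Ext E Z A) : Prop :=
  s Z A δ = X.cls

/-- Exact realizations. -/
structure IsExactRealization {C : Type u} [Category.{v} C] [Preadditive C] [HasZeroObject C]
    (E : Cᵒᵖ ⥤ C ⥤ AddCommGrpCat.{w}) (n : ℕ) [NeZero n] (s : Correspondence E n) : Prop where
  /-- (R0): every morphism of extensions has a lift -/
  lift : ∀ {A Z A' Z' : C} (X : EndedComplex n A Z) (Y : EndedComplex n A' Z')
    (δ : Ext E Z A) (ρ : Ext E Z' A'), Realizes s X δ → Realizes s Y ρ →
    ∀ (a : A ⟶ A') (c : Z ⟶ Z'), push a δ = pull c ρ →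
      ∃ f : X.K ⟶ Y.K, HasEnds (X := X) (Y := Y) f a c
  /-- (R1) -/
  exangle : ∀ {A Z : C} (X : EndedComplex n A Z) (δ : Ext E Z A),
    Realizes s X δ → IsNExangle X δ
  /-- (R2) -/
  zero_left : ∀ A : C, Realizes s (trivLeft n A) (0 : Ext E (0 : C) A)
  /-- (R2), dual part -/
  zero_right : ∀ A : C, Realizes s (trivRight n A) (0 : Ext E A (0 : C))

/-- Distinguished `n`-exangles. -/
def IsDistinguished {C : Type u} [Category.{v} C] [Preadditive C]
    {E : Cᵒᵖ ⥤ C ⥤ AddCommGrpCat.{w}} {n : ℕ} (s : Correspondence E n) {A Z : C}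
    (X : EndedComplex n A Z) (δ : Ext E Z A) : Prop :=
  IsNExangle X δ ∧ Realizes s X δ

/-- `f` is an inflation: up to the identification of `X¹` with `B`, it is the first differential of
a complex `X` realizing some extension. -/
def IsInflation {C : Type u} [Category.{v} C] [Preadditive C]
    {E : Cᵒᵖ ⥤ C ⥤ AddCommGrpCat.{w}} {n : ℕ} (s : Correspondence E n) {A B : C}
    (f : A ⟶ B) : Prop :=
  ∃ (Z : C) (δ : Ext E Z A) (X : EndedComplex n A Z) (e : X.K.X 1 ≅ B),
    Realizes s X δ ∧ X.dFirst ≫ e.hom = f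

/-- `g` is a deflation: up to the identification of `Xⁿ` with `B`, it is the last differential of
a complex `X` realizing some extension. -/
def IsDeflation {C : Type u} [Category.{v} C] [Preadditive C]
    {E : Cᵒᵖ ⥤ C ⥤ AddCommGrpCat.{w}} {n : ℕ} (s : Correspondence E n) {B Z : C}
    (g : B ⟶ Z) : Prop :=
  ∃ (A : C) (δ : Ext E Z A) (X : EndedComplex n A Z) (e : X.K.X n ≅ B),
    Realizes s X δ ∧ e.inv ≫ X.dLast = g

/-- `(C, E, s)` is an `n`-exangulated category (for the additive category `C`). -/
structure IsNExangulated {C : Type u} [Category.{v} C] [Preadditive C] [HasZeroObject C]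
    [HasBinaryBiproducts C] (E : Cᵒᵖ ⥤ C ⥤ AddCommGrpCat.{w}) (n : ℕ) [NeZero n]
    (s : Correspondence E n) : Prop where
  biadditive : IsBiadditive E
  exactRealization : IsExactRealization E n s
  /-- (EA1) -/
  inflation_comp : ∀ {A B D : C} (f : A ⟶ B) (g : B ⟶ D),
    IsInflation s f → IsInflation s g → IsInflation s (f ≫ g)
  /-- (EA1), dual part -/
  deflation_comp : ∀ {A B D : C} (f : A ⟶ B) (g : B ⟶ D),
    IsDeflation s f → IsDeflation s g → IsDeflation s (f ≫ g)
  /-- (EA2): `(id, c)` has a good lift -/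
  good_lift : ∀ {A Z D : C} (c : Z ⟶ D) (ρ : Ext E D A)
    (X : EndedComplex n A Z) (Y : EndedComplex n A D),
    IsDistinguished s X (pull c ρ) → IsDistinguished s Y ρ →
    ∃ f : X.K ⟶ Y.K, HasEnds (X := X) (Y := Y) f (𝟙 A) c ∧
      ∃ M : EndedComplex n (X.K.X 1) D,
        Nonempty (ConeData (X := X) (Y := Y) f M) ∧ IsDistinguished s M (push X.dFirst ρ)
  /-- (EA2ᵒᵖ): `(a, id)` has a good lift -/
  good_lift_op : ∀ {A B Z : C} (a : A ⟶ B) (ρ : Ext E Z A)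
    (X : EndedComplex n A Z) (Y : EndedComplex n B Z),
    IsDistinguished s X ρ → IsDistinguished s Y (push a ρ) →
    ∃ h : X.K ⟶ Y.K, HasEnds (X := X) (Y := Y) h a (𝟙 Z) ∧
      ∃ N : EndedComplex n A (Y.K.X n),
        Nonempty (CoconeData (X := X) (Y := Y) h N) ∧ IsDistinguished s N (pull Y.dLast ρ)

end Realizations

section Angulated

/-! ### `(n+2)`-angulated categories (Geiss–Keller–Oppermann) -/

/-- `S` is an automorphism of the category `C`. -/
def IsAutomorphism {C : Type u} [Category.{v} C] (S : C ⥤ C) : Prop :=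
  ∃ T : C ⥤ C, S ⋙ T = 𝟭 C ∧ T ⋙ S = 𝟭 C

/-- An `(n+2)`-`S`-sequence `X⁰ ⟶ X¹ ⟶ ⋯ ⟶ Xⁿ⁺¹ ⟶ S X⁰`. As for complexes, the terms are indexed
by `ℕ` and vanish outside the degrees `0, …, n+1`. -/
structure SSeq {C : Type u} [Category.{v} C] [Preadditive C] (S : C ⥤ C) (n : ℕ) where
  X : ℕ → C
  d : ∀ i, X i ⟶ X (i + 1)
  w : X (n + 1) ⟶ S.obj (X 0)
  isZero : ∀ i, n + 1 < i → IsZero (X i)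

/-- Morphisms of `(n+2)`-`S`-sequences. -/
structure SSeq.Hom {C : Type u} [Category.{v} C] [Preadditive C] {S : C ⥤ C} {n : ℕ}
    (X Y : SSeq S n) where
  f : ∀ i, X.X i ⟶ Y.X i
  comm : ∀ i, X.d i ≫ f (i + 1) = f i ≫ Y.d i
  comm_w : X.w ≫ S.map (f 0) = f (n + 1) ≫ Y.w

/-- `W` is a direct sum of `X` and `Y` in the category of `(n+2)`-`S`-sequences. -/
structure DirectSumData {C : Type u} [Category.{v} C] [Preadditive C] {S : C ⥤ C} {n : ℕ}
    (X Y W : SSeq S n) where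
  inl : SSeq.Hom X W
  inr : SSeq.Hom Y W
  fst : SSeq.Hom W X
  snd : SSeq.Hom W Y
  inl_fst : ∀ i, inl.f i ≫ fst.f i = 𝟙 (X.X i)
  inr_snd : ∀ i, inr.f i ≫ snd.f i = 𝟙 (Y.X i)
  inl_snd : ∀ i, inl.f i ≫ snd.f i = 0
  inr_fst : ∀ i, inr.f i ≫ fst.f i = 0
  total : ∀ i, fst.f i ≫ inl.f i + snd.f i ≫ inr.f i = 𝟙 (W.X i)

/-- The terms of the trivial sequence. -/
noncomputable def trivialObj {C : Type u} [Category.{v} C] [HasZeroObject C] (A : C) : ℕ → C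
  | 0 => A
  | 1 => A
  | _ + 2 => 0

/-- The trivial sequence `A = A ⟶ 0 ⟶ ⋯ ⟶ 0 ⟶ S A`. -/
noncomputable def trivialSSeq {C : Type u} [Category.{v} C] [Preadditive C] [HasZeroObject C]
    (S : C ⥤ C) (n : ℕ) (A : C) : SSeq S n where
  X := trivialObj A
  d i := match i with
    | 0 => 𝟙 A
    | _ + 1 => 0
  w := 0
  isZero i hi := by
    obtain ⟨k, rfl⟩ : ∃ k, i = k + 2 := ⟨i - 2, by omega⟩
    exact isZero_zero C

/-- Data exhibiting `Y` as the left rotation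
`X¹ ⟶ X² ⟶ ⋯ ⟶ Xⁿ⁺¹ ⟶ S X⁰ ⟶ S X¹` of `X`, with last morphism `(-1)ⁿ S(d⁰)`. -/
structure LeftRotationData {C : Type u} [Category.{v} C] [Preadditive C] {S : C ⥤ C} {n : ℕ}
    (X Y : SSeq S n) where
  e : ∀ i, i ≤ n → (X.X (i + 1) ≅ Y.X i)
  eLast : S.obj (X.X 0) ≅ Y.X (n + 1)
  comm : ∀ i (hi : i + 1 ≤ n),
    X.d (i + 1) ≫ (e (i + 1) hi).hom = (e i (by omega)).hom ≫ Y.d i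
  comm_last : X.w ≫ eLast.hom = (e n le_rfl).hom ≫ Y.d n
  comm_w : (-1 : ℤ) ^ n • S.map (X.d 0) ≫ S.map (e 0 (Nat.zero_le n)).hom = eLast.hom ≫ Y.w

/-- Data exhibiting `W` as the cone
`X¹ ⊞ Y⁰ ⟶ X² ⊞ Y¹ ⟶ ⋯ ⟶ Xⁿ⁺¹ ⊞ Yⁿ ⟶ S X⁰ ⊞ Yⁿ⁺¹ ⟶ S (X¹ ⊞ Y⁰)` of a morphism `φ : X ⟶ Y`. -/
structure SConeData {C : Type u} [Category.{v} C] [Preadditive C] [HasBinaryBiproducts C]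
    {S : C ⥤ C} {n : ℕ} {X Y : SSeq S n} (φ : SSeq.Hom X Y) (W : SSeq S n) where
  e : ∀ i, i ≤ n → (W.X i ≅ X.X (i + 1) ⊞ Y.X i)
  eLast : W.X (n + 1) ≅ S.obj (X.X 0) ⊞ Y.X (n + 1)
  comm : ∀ i (hi : i + 1 ≤ n),
    W.d i ≫ (e (i + 1) hi).hom = (e i (by omega)).hom ≫
      Biprod.ofComponents (-X.d (i + 1)) (φ.f (i + 1)) 0 (Y.d i)
  comm_last : W.d n ≫ eLast.hom = (e n le_rfl).hom ≫
    Biprod.ofComponents (-X.w) (φ.f (n + 1)) 0 (Y.d n)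
  comm_w : W.w ≫ S.map (e 0 (Nat.zero_le n)).hom = eLast.hom ≫
    biprod.desc (-S.map (X.d 0) ≫ S.map biprod.inl + S.map (φ.f 0) ≫ S.map biprod.inr)
      (Y.w ≫ S.map biprod.inr)

/-- The class `box` of `(n+2)`-`S`-sequences makes `(C, S, box)` an `(n+2)`-angulated category. -/
structure IsAngulation {C : Type u} [Category.{v} C] [Preadditive C] [HasZeroObject C]
    [HasBinaryBiproducts C] (S : C ⥤ C) (n : ℕ) (box : Set (SSeq S n)) : Prop where
  automorphism : IsAutomorphism S
  /-- (F1)(a): closed under direct sums and under direct summands (hence under isomorphisms) -/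
  directSum : ∀ X Y W : SSeq S n, Nonempty (DirectSumData X Y W) →
    (W ∈ box ↔ X ∈ box ∧ Y ∈ box)
  /-- (F1)(b) -/
  trivial : ∀ A : C, trivialSSeq S n A ∈ box
  /-- (F1)(c): each morphism is the first morphism of an `(n+2)`-angle -/
  complete : ∀ {A B : C} (f : A ⟶ B), ∃ X ∈ box, ∃ (e₀ : X.X 0 ≅ A) (e₁ : X.X 1 ≅ B),
    X.d 0 ≫ e₁.hom = e₀.hom ≫ f
  /-- (F2) -/
  rotate : ∀ X Y : SSeq S n, Nonempty (LeftRotationData X Y) → (X ∈ box ↔ Y ∈ box)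
  /-- (F3) -/
  extend : ∀ X ∈ box, ∀ Y ∈ box, ∀ (a : X.X 0 ⟶ Y.X 0) (b : X.X 1 ⟶ Y.X 1),
    X.d 0 ≫ b = a ≫ Y.d 0 → ∃ φ : SSeq.Hom X Y, φ.f 0 = a ∧ φ.f 1 = b
  /-- (F4) -/
  extend_cone : ∀ X ∈ box, ∀ Y ∈ box, ∀ (a : X.X 0 ⟶ Y.X 0) (b : X.X 1 ⟶ Y.X 1),
    X.d 0 ≫ b = a ≫ Y.d 0 → ∃ φ : SSeq.Hom X Y, φ.f 0 = a ∧ φ.f 1 = b ∧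
      ∃ W ∈ box, Nonempty (SConeData φ W)

/-- The bifunctor `E_S = C(-, S -)`. -/
def ESigma {C : Type u} [Category.{v} C] [Preadditive C] (S : C ⥤ C) :
    Cᵒᵖ ⥤ C ⥤ AddCommGrpCat.{v} where
  obj Z :=
    { obj := fun A => AddCommGrpCat.of (Z.unop ⟶ S.obj A)
      map := fun a => AddCommGrpCat.ofHom (Preadditive.rightComp Z.unop (S.map a))
      map_id := fun A => by ext δ; simp [Preadditive.rightComp]
      map_comp := fun a b => by ext δ; simp [Preadditive.rightComp] }
  map c :=
    { app := fun A => AddCommGrpCat.ofHom (Preadditive.leftComp (S.obj A) c.unop)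
      naturality := fun A B a => by
        ext δ; simp [Preadditive.rightComp, Preadditive.leftComp] }
  map_id Z := by ext A δ; simp [Preadditive.leftComp]
  map_comp c c' := by ext A δ; simp [Preadditive.leftComp]

theorem push_ESigma {C : Type u} [Category.{v} C] [Preadditive C] (S : C ⥤ C) {Z A A' : C}
    (a : A ⟶ A') (δ : Z ⟶ S.obj A) : push (E := ESigma S) a δ = δ ≫ S.map a := rfl

theorem pull_ESigma {C : Type u} [Category.{v} C] [Preadditive C] (S : C ⥤ C) {Z Z' A : C}
    (c : Z' ⟶ Z) (δ : Z ⟶ S.obj A) : pull (E := ESigma S) c δ = c ≫ δ := rfl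

/-- The `(n+2)`-`S`-sequence `A ⟶ X¹ ⟶ ⋯ ⟶ Xⁿ ⟶ Z ⟶ S A` given by a complex `X` with end terms
`A` and `Z` and a morphism `δ : Z ⟶ S A`. -/
def EndedComplex.toSSeq {C : Type u} [Category.{v} C] [Preadditive C] {S : C ⥤ C} {n : ℕ}
    {A Z : C} (X : EndedComplex n A Z) (δ : Z ⟶ S.obj A) : SSeq S n where
  X := X.K.X
  d i := X.K.d i (i + 1)
  w := X.right.hom ≫ δ ≫ S.map X.left.inv
  isZero := X.isZero

end Angulated

end NExangulated

/-!
The realization sends `δ : Z ⟶ S A` to the class of the angles `A ⟶ X¹ ⟶ ⋯ ⟶ Xⁿ ⟶ Z ⟶ S A` with last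
morphism `δ`. Such angles exist because every morphism is the first morphism of an angle and angles
can be rotated (`PreSeq.exists_inBox_w`).

*Well-definedness.* Two angles with the same last morphism are connected by lifts of the identities
in both directions. The composites differ from the identity by an endomorphism `θ` that vanishes on
the end terms. The exactness of angles makes `θ²`, though not `θ` itself, null homotopic
(`IsAngulation.exists_homotopy_sq`), so `1 + θ` is a homotopy equivalence with homotopy inverse
`1 - θ` (`IsAngulation.htpyEquivalent`). Conversely, a complex homotopy equivalent to an angle,
relative to the end terms, is an angle: it is a direct summand of the sum of that angle and a
contractible one (`IsAngulation.mem_of_htpyEquivalent`). Hence `X` realizes `δ` if and only if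
`(X, δ)` is an angle (`IsAngulation.realizes_iff`), and the axioms become statements about angles.

*Lifts.* Applying the cone axiom to right rotations yields, for every morphism `(a, c)` of
extensions, a lift whose rotated mapping cone
`X⁰ ⊞ V ⟶ X¹ ⊞ Y⁰ ⟶ ⋯ ⟶ Xⁿ⁺¹ ⊞ Yⁿ ⟶ S (X⁰ ⊞ V)`, where `S V = Yⁿ⁺¹`, is an angle
(`PreSeq.exists_hom_rotCone`, `IsAngulation.exists_lift`). If `a` is an isomorphism, then the
contractible piece `X⁰ = Y⁰` splits off and leaves the right rotation of the mapping cone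
(`IsAngulation.inBox_cone`). If `c` is an isomorphism, then the piece `Xⁿ⁺¹ = Yⁿ⁺¹` splits off and
leaves the mapping cocone (`IsAngulation.inBox_cocone`). A retract of an angle is known to be an
angle only if it is a direct summand, so in each case the complement is given explicitly
(`PreSeq.InBox.of_retract`).

*The remaining axioms.* Exactness is the usual consequence of comparing an angle with trivial ones.
Since every morphism is both an inflation and a deflation, closure under composition is automatic.

The terms of a sequence are indexed by `ℕ`, with zeros in degrees `> n + 1`. Uniform formulas for
rotations and cones produce other terms there; they are therefore stated for `PreSeq`, where these
terms are ignored, and `PreSeq.trunc` discards them.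
-/

namespace NExangulated

/-! ### Brutal truncation of families of objects -/

section Cut

variable {C : Type u} [Category.{v} C] [HasZeroObject C]

/-- The family of objects `F`, replaced by zero in degrees `> m`. -/
noncomputable def cutObj (m : ℕ) (F : ℕ → C) (i : ℕ) : C :=
  if i ≤ m then F i else 0

theorem isZero_cutObj {m : ℕ} (F : ℕ → C) {i : ℕ} (h : m < i) : IsZero (cutObj m F i) := by
  rw [cutObj, if_neg (by omega)]
  exact isZero_zero C

variable [Preadditive C]

/-- The canonical morphism to the truncated family: the identity in degrees `≤ m`. -/
noncomputable def cutIn (m : ℕ) (F : ℕ → C) (i : ℕ) : F i ⟶ cutObj m F i :=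
  if h : i ≤ m then eqToHom (show F i = cutObj m F i from (if_pos h).symm) else 0

/-- The canonical morphism from the truncated family: the identity in degrees `≤ m`. -/
noncomputable def cutOut (m : ℕ) (F : ℕ → C) (i : ℕ) : cutObj m F i ⟶ F i :=
  if h : i ≤ m then eqToHom (show cutObj m F i = F i from if_pos h) else 0

@[simp]
theorem cutOut_cutIn (m : ℕ) (F : ℕ → C) (i : ℕ) :
    cutOut m F i ≫ cutIn m F i = 𝟙 _ := by
  by_cases h : i ≤ m
  · simp only [cutOut, cutIn, h, dif_pos, eqToHom_trans, eqToHom_refl]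
  · exact (isZero_cutObj F (by omega)).eq_of_src _ _

theorem cutIn_cutOut {m : ℕ} (F : ℕ → C) {i : ℕ} (h : i ≤ m) :
    cutIn m F i ≫ cutOut m F i = 𝟙 _ := by
  simp only [cutOut, cutIn, h, dif_pos, eqToHom_trans, eqToHom_refl]

/-- Below the truncation degree nothing changes. -/
noncomputable abbrev cutIso {m : ℕ} (F : ℕ → C) {i : ℕ} (h : i ≤ m) : cutObj m F i ≅ F i where
  hom := cutOut m F i
  inv := cutIn m F i
  hom_inv_id := cutOut_cutIn m F i
  inv_hom_id := cutIn_cutOut F h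

/-- The morphism induced between truncated families. -/
noncomputable def cutMap (m : ℕ) {F G : ℕ → C} {i j : ℕ} (f : F i ⟶ G j) :
    cutObj m F i ⟶ cutObj m G j :=
  cutOut m F i ≫ f ≫ cutIn m G j

@[simp]
theorem cutMap_id (m : ℕ) (F : ℕ → C) (i : ℕ) :
    cutMap m (F := F) (G := F) (𝟙 (F i)) = 𝟙 _ := by
  simp [cutMap]

@[simp]
theorem cutMap_zero (m : ℕ) (F G : ℕ → C) (i j : ℕ) :
    cutMap m (F := F) (G := G) (0 : F i ⟶ G j) = 0 := by
  simp [cutMap]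

theorem cutMap_add (m : ℕ) {F G : ℕ → C} {i j : ℕ} (f g : F i ⟶ G j) :
    cutMap m (f + g) = cutMap m f + cutMap m g := by
  simp [cutMap]

theorem cutMap_comp {m : ℕ} {F G H : ℕ → C} {i j k : ℕ} (h : j ≤ m) (f : F i ⟶ G j)
    (g : G j ⟶ H k) : cutMap m f ≫ cutMap m g = cutMap m (f ≫ g) := by
  have := cutIn_cutOut G h
  simp [cutMap, reassoc_of% this]

end Cut

/-! ### Sequences with irrelevant terms in high degrees -/

/-- An `(n+2)`-`S`-sequence `X⁰ ⟶ X¹ ⟶ ⋯ ⟶ Xⁿ⁺¹ ⟶ S X⁰` together with arbitrary terms and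
morphisms in higher degrees, which are to be ignored. Dropping the vanishing condition of `SSeq`
makes rotations and cones definable by uniform formulas. -/
structure PreSeq {C : Type u} [Category.{v} C] [Preadditive C] (S : C ⥤ C) (n : ℕ) where
  X : ℕ → C
  d : ∀ i, X i ⟶ X (i + 1)
  w : X (n + 1) ⟶ S.obj (X 0)

namespace PreSeq

variable {C : Type u} [Category.{v} C] [Preadditive C] {S : C ⥤ C} {n : ℕ}

/-- Morphisms of `(n+2)`-`S`-sequences; the components in degrees `> n + 1` are irrelevant. -/
structure Hom (U V : PreSeq S n) where
  f : ∀ i, U.X i ⟶ V.X i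
  comm : ∀ i, i ≤ n → U.d i ≫ f (i + 1) = f i ≫ V.d i
  comm_w : U.w ≫ S.map (f 0) = f (n + 1) ≫ V.w

/-- `W` is a direct sum of `U` and `V` in the relevant degrees. -/
structure DirectSum (U V W : PreSeq S n) where
  inl : Hom U W
  inr : Hom V W
  fst : Hom W U
  snd : Hom W V
  inl_fst : ∀ i, i ≤ n + 1 → inl.f i ≫ fst.f i = 𝟙 (U.X i)
  inr_snd : ∀ i, i ≤ n + 1 → inr.f i ≫ snd.f i = 𝟙 (V.X i)
  inl_snd : ∀ i, i ≤ n + 1 → inl.f i ≫ snd.f i = 0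
  inr_fst : ∀ i, i ≤ n + 1 → inr.f i ≫ fst.f i = 0
  total : ∀ i, i ≤ n + 1 → fst.f i ≫ inl.f i + snd.f i ≫ inr.f i = 𝟙 (W.X i)

variable [HasZeroObject C]

/-- The `(n+2)`-`S`-sequence obtained by discarding the irrelevant terms. -/
noncomputable abbrev trunc (U : PreSeq S n) : SSeq S n where
  X := cutObj (n + 1) U.X
  d i := cutMap (n + 1) (U.d i)
  w := cutOut (n + 1) U.X (n + 1) ≫ U.w ≫ S.map (cutIn (n + 1) U.X 0)
  isZero _ hi := isZero_cutObj _ hi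

/-- The morphism induced on truncations. -/
noncomputable abbrev Hom.trunc {U V : PreSeq S n} (φ : Hom U V) : SSeq.Hom U.trunc V.trunc where
  f i := cutMap (n + 1) (φ.f i)
  comm i := by
    by_cases hi : i ≤ n
    · dsimp [PreSeq.trunc]
      rw [cutMap_comp (by omega), cutMap_comp (by omega), φ.comm i hi]
    · exact (V.trunc.isZero (i + 1) (by omega)).eq_of_tgt _ _
  comm_w := by
    have h1 := cutIn_cutOut U.X (Nat.zero_le (n + 1))
    have h2 := cutIn_cutOut V.X (le_refl (n + 1))
    dsimp [PreSeq.trunc, cutMap]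
    simp only [Category.assoc, ← S.map_comp, reassoc_of% h1, reassoc_of% h2]
    simp only [S.map_comp, reassoc_of% φ.comm_w]

/-- The truncation represents a sequence in the given class `box`. -/
def InBox (box : Set (SSeq S n)) (U : PreSeq S n) : Prop :=
  U.trunc ∈ box

/-- A direct sum decomposition induces one of the truncations. -/
noncomputable def DirectSum.trunc {U V W : PreSeq S n} (D : DirectSum U V W) :
    DirectSumData U.trunc V.trunc W.trunc where
  inl := D.inl.trunc
  inr := D.inr.trunc
  fst := D.fst.trunc
  snd := D.snd.trunc
  inl_fst i := by
    by_cases hi : i ≤ n + 1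
    · dsimp [Hom.trunc]
      rw [cutMap_comp hi, D.inl_fst i hi, cutMap_id]
    · exact (U.trunc.isZero i (by omega)).eq_of_src _ _
  inr_snd i := by
    by_cases hi : i ≤ n + 1
    · dsimp [Hom.trunc]
      rw [cutMap_comp hi, D.inr_snd i hi, cutMap_id]
    · exact (V.trunc.isZero i (by omega)).eq_of_src _ _
  inl_snd i := by
    by_cases hi : i ≤ n + 1
    · dsimp [Hom.trunc]
      rw [cutMap_comp hi, D.inl_snd i hi, cutMap_zero]
    · exact (U.trunc.isZero i (by omega)).eq_of_src _ _
  inr_fst i := by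
    by_cases hi : i ≤ n + 1
    · dsimp [Hom.trunc]
      rw [cutMap_comp hi, D.inr_fst i hi, cutMap_zero]
    · exact (V.trunc.isZero i (by omega)).eq_of_src _ _
  total i := by
    by_cases hi : i ≤ n + 1
    · dsimp [Hom.trunc]
      rw [cutMap_comp hi, cutMap_comp hi, ← cutMap_add, D.total i hi, cutMap_id]
    · exact (W.trunc.isZero i (by omega)).eq_of_src _ _

end PreSeq

/-- An `(n+2)`-`S`-sequence, with its vanishing terms forgotten. -/
abbrev SSeq.toPre {C : Type u} [Category.{v} C] [Preadditive C] {S : C ⥤ C} {n : ℕ}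
    (X : SSeq S n) : PreSeq S n where
  X := X.X
  d := X.d
  w := X.w

/-! ### Closure properties of the class of angles -/

/-- The automorphism of an angulated category is an equivalence. -/
theorem IsAutomorphism.isEquivalence {C : Type u} [Category.{v} C] {S : C ⥤ C}
    (h : IsAutomorphism S) : S.IsEquivalence := by
  obtain ⟨T, h1, h2⟩ := h
  exact (CategoryTheory.Equivalence.mk S T (eqToIso h1.symm) (eqToIso h2)).isEquivalence_functor

section Closure

variable {C : Type u} [Category.{v} C] [Preadditive C] [HasZeroObject C]
  [HasBinaryBiproducts C] {S : C ⥤ C} {n : ℕ} {box : Set (SSeq S n)}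

/-- The automorphism of an angulated category is additive, since it preserves biproducts. -/
theorem IsAutomorphism.additive (h : IsAutomorphism S) : S.Additive := by
  have := h.isEquivalence
  exact Functor.additive_of_preserves_binary_products S

/-- The class of angles is closed under isomorphisms. -/
theorem IsAngulation.mem_of_iso (hbox : IsAngulation S n box) {X Y : SSeq S n}
    (φ : SSeq.Hom X Y) (hφ : ∀ i, i ≤ n + 1 → IsIso (φ.f i)) (hX : X ∈ box) : Y ∈ box := by
  have := hbox.automorphism.additive
  have hiso : ∀ i, IsIso (φ.f i) := fun i => by
    by_cases hi : i ≤ n + 1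
    · exact hφ i hi
    · exact ⟨0, (X.isZero i (by omega)).eq_of_src _ _, (Y.isZero i (by omega)).eq_of_src _ _⟩
  have hz : ∀ i, IsZero ((trivialSSeq S n (0 : C)).X i) := fun i => by
    match i with
    | 0 => exact isZero_zero C
    | 1 => exact isZero_zero C
    | _ + 2 => exact isZero_zero C
  -- `Y` is the direct sum of `X` and a zero sequence
  refine ((hbox.directSum X (trivialSSeq S n 0) Y ⟨?_⟩).2 ⟨hX, hbox.trivial 0⟩)
  exact
    { inl := φ
      inr := ⟨fun i => 0, fun i => by simp, by simp⟩
      fst := ⟨fun i => inv (φ.f i), fun i => by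
          rw [← cancel_epi (φ.f i), IsIso.hom_inv_id_assoc, ← reassoc_of% (φ.comm i)]
          simp,
        by rw [S.map_inv, IsIso.comp_inv_eq, Category.assoc, φ.comm_w, IsIso.inv_hom_id_assoc]⟩
      snd := ⟨fun i => 0, fun i => by simp, by simp⟩
      inl_fst := fun i => by simp
      inr_snd := fun i => (hz i).eq_of_src _ _
      inl_snd := fun i => by simp
      inr_fst := fun i => by simp
      total := fun i => by simp }

namespace PreSeq

theorem InBox.of_iso (hbox : IsAngulation S n box) {U V : PreSeq S n} (φ : Hom U V)
    (hφ : ∀ i, i ≤ n + 1 → IsIso (φ.f i)) (hU : U.InBox box) : V.InBox box :=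
  hbox.mem_of_iso φ.trunc (fun i hi => ⟨cutMap (n + 1) (have := hφ i hi; inv (φ.f i)), by
      have := hφ i hi
      constructor <;> dsimp [Hom.trunc] <;> rw [cutMap_comp hi] <;> simp⟩) hU

theorem inBox_toPre (hbox : IsAngulation S n box) (X : SSeq S n) :
    X.toPre.InBox box ↔ X ∈ box := by
  have hin : ∀ i, i ≤ n + 1 → IsIso (cutIn (n + 1) X.X i) := fun i hi => (cutIso X.X hi).isIso_inv
  constructor
  · refine hbox.mem_of_iso ⟨fun i => cutOut (n + 1) X.X i, fun i => ?_, ?_⟩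
      (fun i hi => (cutIso X.X hi).isIso_hom)
    · by_cases hi : i + 1 ≤ n + 1
      · simp [trunc, cutMap, cutIn_cutOut X.X hi]
      · exact (X.isZero (i + 1) (by omega)).eq_of_tgt _ _
    · simp [trunc, ← S.map_comp, cutIn_cutOut X.X (Nat.zero_le _), SSeq.toPre]
  · refine hbox.mem_of_iso ⟨fun i => cutIn (n + 1) X.X i, fun i => ?_, ?_⟩ hin
    · by_cases hi : i ≤ n + 1
      · have := cutIn_cutOut X.X hi
        simp [trunc, cutMap, SSeq.toPre, reassoc_of% this]
      · exact (X.toPre.trunc.isZero (i + 1) (by omega)).eq_of_tgt _ _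
    · have := cutIn_cutOut X.X (le_refl (n + 1))
      simp [trunc, SSeq.toPre, reassoc_of% this]

theorem DirectSum.inBox_iff (hbox : IsAngulation S n box) {U V W : PreSeq S n}
    (D : DirectSum U V W) : W.InBox box ↔ U.InBox box ∧ V.InBox box :=
  hbox.directSum _ _ _ ⟨D.trunc⟩

/-- A retract `Y` of an angle `W` is an angle as soon as the complementary idempotent splits in
each degree: then `Y` is a direct summand, the complement inheriting the structure of a sequence
from `W`. -/
theorem InBox.of_retract (hbox : IsAngulation S n box) {Y W : PreSeq S n} (s : Hom Y W)
    (p : Hom W Y) (hsp : ∀ i, i ≤ n + 1 → s.f i ≫ p.f i = 𝟙 _)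
    (hker : ∀ i, i ≤ n + 1 → ∃ (K : C) (k : K ⟶ W.X i) (q : W.X i ⟶ K),
      k ≫ q = 𝟙 _ ∧ p.f i ≫ s.f i + q ≫ k = 𝟙 _)
    (hW : W.InBox box) : Y.InBox box := by
  have := hbox.automorphism.additive
  have hker' : ∀ i, ∃ (K : C) (k : K ⟶ W.X i) (q : W.X i ⟶ K), i ≤ n + 1 →
      k ≫ q = 𝟙 _ ∧ p.f i ≫ s.f i + q ≫ k = 𝟙 _ := fun i => by
    by_cases hi : i ≤ n + 1
    · obtain ⟨K, k, q, h⟩ := hker i hi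
      exact ⟨K, k, q, fun _ => h⟩
    · exact ⟨0, 0, 0, fun h => absurd h hi⟩
  choose K k q hK using hker'
  have hkp : ∀ i, i ≤ n + 1 → k i ≫ p.f i = 0 := fun i hi => by
    have h := k i ≫= (hK i hi).2 =≫ p.f i
    simpa [hsp i hi, reassoc_of% (hK i hi).1] using h
  have hsq : ∀ i, i ≤ n + 1 → s.f i ≫ q i = 0 := fun i hi => by
    have h := s.f i ≫= (hK i hi).2 =≫ q i
    simpa [reassoc_of% (hsp i hi), (hK i hi).1] using h
  have hqk : ∀ i, i ≤ n + 1 → q i ≫ k i = 𝟙 _ - p.f i ≫ s.f i := fun i hi => by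
    rw [← (hK i hi).2]; abel
  let V : PreSeq S n :=
    { X := K, d := fun i => k i ≫ W.d i ≫ q (i + 1), w := k (n + 1) ≫ W.w ≫ S.map (q 0) }
  let D : DirectSum Y V W :=
    { inl := s
      fst := p
      inr := ⟨k, fun i hi => by
          simp only [V, Category.assoc, hqk (i + 1) (by omega)]
          rw [Preadditive.comp_sub, Preadditive.comp_sub, reassoc_of% (p.comm i hi),
            reassoc_of% (hkp i (by omega))]
          simp, by
          simp only [V, Category.assoc, ← S.map_comp, hqk 0 (by omega)]
          rw [S.map_sub, Preadditive.comp_sub, Preadditive.comp_sub, S.map_comp,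
            reassoc_of% p.comm_w, reassoc_of% (hkp (n + 1) le_rfl)]
          simp⟩
      snd := ⟨q, fun i hi => by
          simp only [V]
          rw [reassoc_of% (hqk i (by omega)), Preadditive.sub_comp, Category.assoc,
            ← reassoc_of% (s.comm i hi), hsq (i + 1) (by omega)]
          simp, by
          simp only [V]
          rw [reassoc_of% (hqk (n + 1) le_rfl), Preadditive.sub_comp, Category.assoc,
            ← reassoc_of% s.comm_w, ← S.map_comp, hsq 0 (by omega)]
          simp⟩
      inl_fst := hsp
      inr_snd := fun i hi => (hK i hi).1
      inl_snd := hsq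
      inr_fst := hkp
      total := fun i hi => (hK i hi).2 }
  exact ((D.inBox_iff hbox).1 hW).1

/-- The right rotation `V ⟶ X⁰ ⟶ ⋯ ⟶ Xⁿ ⟶ S V` of a sequence `U`, where `S V` is identified
with `Xⁿ⁺¹` by `κ`, and `v : V ⟶ X⁰` is its first morphism. -/
abbrev rightRot (U : PreSeq S n) {V : C} (v : V ⟶ U.X 0) (κ : S.obj V ≅ U.X (n + 1)) :
    PreSeq S n where
  X i := match i with
    | 0 => V
    | j + 1 => U.X j
  d i := match i with
    | 0 => v
    | j + 1 => U.d j
  w := U.d n ≫ κ.inv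

theorem inBox_rightRot (hbox : IsAngulation S n box) (U : PreSeq S n) {V : C} (v : V ⟶ U.X 0)
    (κ : S.obj V ≅ U.X (n + 1)) (hv : S.map v = (-1 : ℤ) ^ n • κ.hom ≫ U.w) :
    (U.rightRot v κ).InBox box ↔ U.InBox box := by
  have := hbox.automorphism.additive
  refine hbox.rotate _ _ ⟨?_⟩
  exact
    { e := fun i hi => cutIso (U.rightRot v κ).X (i := i + 1) (by omega) ≪≫
        (cutIso U.X (i := i) (by omega)).symm
      eLast := S.mapIso (cutIso (U.rightRot v κ).X (Nat.zero_le (n + 1))) ≪≫ κ ≪≫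
        (cutIso U.X (le_refl (n + 1))).symm
      comm := fun i hi => by
        have h1 := cutIn_cutOut (U.rightRot v κ).X (show i + 1 + 1 ≤ n + 1 by omega)
        have h2 := cutIn_cutOut U.X (show i ≤ n + 1 by omega)
        simp [trunc, cutIso, cutMap, reassoc_of% h1, reassoc_of% h2]
      comm_last := by
        have h1 := cutIn_cutOut (U.rightRot v κ).X (Nat.zero_le (n + 1))
        have h2 := cutIn_cutOut U.X (show n ≤ n + 1 by omega)
        simp [trunc, cutIso, cutMap, reassoc_of% h2, ← S.map_comp_assoc, h1]
      comm_w := by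
        have h1 := cutIn_cutOut (U.rightRot v κ).X (show 0 + 1 ≤ n + 1 by omega)
        have h2 := cutIn_cutOut U.X (le_refl (n + 1))
        have hv' := hv =≫ S.map (cutIn (n + 1) U.X 0)
        simp only [Preadditive.zsmul_comp, Category.assoc] at hv'
        simp only [Iso.trans_hom, Iso.symm_hom, Functor.mapIso_hom, cutMap, Category.assoc,
          ← S.map_comp, reassoc_of% h2, reassoc_of% h1]
        simp only [S.map_comp, hv', Preadditive.comp_zsmul, smul_smul, ← mul_pow]
        simp }

/-- Every sequence can be rotated to the right. -/
theorem exists_rightRot (hbox : IsAngulation S n box) (U : PreSeq S n) :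
    ∃ (V : C) (v : V ⟶ U.X 0) (κ : S.obj V ≅ U.X (n + 1)),
      S.map v = (-1 : ℤ) ^ n • κ.hom ≫ U.w := by
  have := hbox.automorphism.isEquivalence
  exact ⟨S.objPreimage (U.X (n + 1)), S.preimage _, S.objObjPreimageIso _, S.map_preimage _⟩

end PreSeq

end Closure

/-! ### Lifts with prescribed end components and their cones -/

section Matrices

variable {C : Type u} [Category.{v} C] [Preadditive C] [HasBinaryBiproducts C]
  {A A' A'' B B' B'' : C}

theorem ofComponents_map (p : A ⟶ A') (q : A ⟶ B') (r : B ⟶ A') (s : B ⟶ B') (x : A' ⟶ A'')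
    (y : B' ⟶ B'') : Biprod.ofComponents p q r s ≫ biprod.map x y =
      Biprod.ofComponents (p ≫ x) (q ≫ y) (r ≫ x) (s ≫ y) := by
  ext <;> simp [Biprod.ofComponents]

theorem map_ofComponents (p : A' ⟶ A'') (q : A' ⟶ B'') (r : B' ⟶ A'') (s : B' ⟶ B'')
    (x : A ⟶ A') (y : B ⟶ B') : biprod.map x y ≫ Biprod.ofComponents p q r s =
      Biprod.ofComponents (x ≫ p) (x ≫ q) (y ≫ r) (y ≫ s) := by
  ext <;> simp [Biprod.ofComponents]

end Matrices

namespace PreSeq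

variable {C : Type u} [Category.{v} C] [Preadditive C] [HasBinaryBiproducts C] {S : C ⥤ C} {n : ℕ}

/-- Data exhibiting `W` as the cone of a morphism `φ` of sequences with irrelevant terms, with the
conventions of `SConeData`. -/
structure PreConeData {U V : PreSeq S n} (φ : Hom U V) (W : PreSeq S n) where
  e : ∀ i, i ≤ n → (W.X i ≅ U.X (i + 1) ⊞ V.X i)
  eLast : W.X (n + 1) ≅ S.obj (U.X 0) ⊞ V.X (n + 1)
  comm : ∀ i (hi : i + 1 ≤ n),
    W.d i ≫ (e (i + 1) hi).hom = (e i (by omega)).hom ≫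
      Biprod.ofComponents (-U.d (i + 1)) (φ.f (i + 1)) 0 (V.d i)
  comm_last : W.d n ≫ eLast.hom = (e n le_rfl).hom ≫
    Biprod.ofComponents (-U.w) (φ.f (n + 1)) 0 (V.d n)
  comm_w : W.w ≫ S.map (e 0 (Nat.zero_le n)).hom = eLast.hom ≫
    biprod.desc (-S.map (U.d 0) ≫ S.map biprod.inl + S.map (φ.f 0) ≫ S.map biprod.inr)
      (V.w ≫ S.map biprod.inr)

variable [HasZeroObject C] {box : Set (SSeq S n)}

/-- The axiom (F4) for sequences with irrelevant terms. -/
theorem exists_hom_cone (hbox : IsAngulation S n box) [NeZero n] {U V : PreSeq S n}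
    (hU : U.InBox box) (hV : V.InBox box) (a : U.X 0 ⟶ V.X 0) (b : U.X 1 ⟶ V.X 1)
    (h : U.d 0 ≫ b = a ≫ V.d 0) : ∃ φ : Hom U V, φ.f 0 = a ∧ φ.f 1 = b ∧
      ∃ W : PreSeq S n, W.InBox box ∧ Nonempty (PreConeData φ W) := by
  have := hbox.automorphism.additive
  have hn : 0 < n := NeZero.pos n
  have o {F : ℕ → C} {i : ℕ} (hi : i ≤ n + 1) := cutIn_cutOut F hi
  obtain ⟨φ, h0, h1, W, hW, ⟨D⟩⟩ := hbox.extend_cone _ hU _ hV (cutMap (n + 1) a)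
    (cutMap (n + 1) b) (by rw [cutMap_comp (by omega), cutMap_comp (by omega), h])
  obtain ⟨g, hg⟩ : ∃ g : ∀ i, U.X i ⟶ V.X i, ∀ i, φ.f i = cutMap (n + 1) (g i) :=
    ⟨fun i => cutIn _ _ _ ≫ φ.f i ≫ cutOut _ _ _, fun i => by
      rw [cutMap, Category.assoc, Category.assoc, cutOut_cutIn, Category.comp_id,
        reassoc_of% cutOut_cutIn (n + 1) U.X i]⟩
  have inj {i j : ℕ} (hi : i ≤ n + 1) (hj : j ≤ n + 1) {x y : U.X i ⟶ V.X j}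
      (hxy : cutMap (n + 1) x = cutMap (n + 1) y) : x = y := by
    have := cutIn _ _ _ ≫= hxy =≫ cutOut _ _ _
    simpa only [cutMap, Category.assoc, o hj, reassoc_of% (o hi), Category.comp_id] using this
  let φ' : Hom U V :=
    { f := g
      comm := fun i hi => inj (by omega) (by omega) (by
        rw [← cutMap_comp (by omega), ← cutMap_comp (by omega), ← hg, ← hg, φ.comm i])
      comm_w := by
        have := cutIn _ U.X _ ≫= φ.comm_w =≫ S.map (cutOut (n + 1) V.X 0)
        simpa only [hg, cutMap, Category.assoc, ← S.map_comp, o (le_refl (n + 1)),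
          o (Nat.zero_le (n + 1)), reassoc_of% (o (le_refl (n + 1))),
          reassoc_of% (o (Nat.zero_le (n + 1))), Category.comp_id, S.map_id] using this }
  refine ⟨φ', inj (by omega) (by omega) ((hg 0).symm.trans h0),
    inj (by omega) (by omega) ((hg 1).symm.trans h1), W.toPre, (inBox_toPre hbox W).2 hW, ⟨?_⟩⟩
  exact
    { e := fun i hi => D.e i hi ≪≫ biprod.mapIso (cutIso U.X (by omega)) (cutIso V.X (by omega))
      eLast := D.eLast ≪≫
        biprod.mapIso (S.mapIso (cutIso U.X (Nat.zero_le (n + 1)))) (cutIso V.X (by omega))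
      comm := fun i hi => by
        simp only [Iso.trans_hom, biprod.mapIso_hom, Category.assoc]
        rw [reassoc_of% (D.comm i hi), ofComponents_map, map_ofComponents, hg]
        simp only [cutMap, Preadditive.neg_comp, Preadditive.comp_neg, Category.assoc, φ',
          o (show i + 1 ≤ n + 1 by omega), o (show i + 1 + 1 ≤ n + 1 by omega),
          Category.comp_id, zero_comp, comp_zero]
      comm_last := by
        simp only [Iso.trans_hom, biprod.mapIso_hom, Category.assoc]
        rw [reassoc_of% D.comm_last, ofComponents_map, map_ofComponents, hg]
        simp only [cutMap, Preadditive.neg_comp, Preadditive.comp_neg, Category.assoc, φ',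
          Functor.mapIso_hom, ← S.map_comp, o (show n + 1 ≤ n + 1 by omega), S.map_id,
          o (show 0 ≤ n + 1 by omega), Category.comp_id, zero_comp, comp_zero]
      comm_w := by
        simp only [Iso.trans_hom, biprod.mapIso_hom, S.map_comp, Category.assoc]
        rw [reassoc_of% D.comm_w]
        congr 1
        ext
        · simp only [biprod.inl_desc_assoc, biprod.inl_map_assoc, biprod.inl_desc,
            Preadditive.neg_comp, Preadditive.add_comp, Preadditive.comp_add,
            Preadditive.comp_neg, Category.assoc, ← S.map_comp, hg, φ', Functor.mapIso_hom,
            biprod.inl_map, biprod.inr_map, cutMap, reassoc_of% (o (show 1 ≤ n + 1 by omega)),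
            reassoc_of% (o (show 0 ≤ n + 1 by omega))]
        · simp only [biprod.inr_desc_assoc, biprod.inr_map_assoc, biprod.inr_desc, Category.assoc,
            ← S.map_comp, biprod.inr_map, reassoc_of% (o (show 0 ≤ n + 1 by omega))] }

/-- The mapping cone of the right rotation of a morphism `f : U ⟶ U'`, namely
`X⁰ ⊞ V ⟶ X¹ ⊞ Y⁰ ⟶ ⋯ ⟶ Xⁿ⁺¹ ⊞ Yⁿ ⟶ S (X⁰ ⊞ V)`, where `v : V ⟶ Y⁰` is the first morphism of the
right rotation of `U'`. -/
noncomputable abbrev rotCone {U U' : PreSeq S n} (f : Hom U U') {V : C} (v : V ⟶ U'.X 0)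
    (κ : S.obj V ≅ U'.X (n + 1)) : PreSeq S n where
  X i := match i with
    | 0 => U.X 0 ⊞ V
    | j + 1 => U.X (j + 1) ⊞ U'.X j
  d i := match i with
    | 0 => Biprod.ofComponents (-U.d 0) (f.f 0) 0 v
    | j + 1 => Biprod.ofComponents (-U.d (j + 1)) (f.f (j + 1)) 0 (U'.d j)
  w := biprod.desc
    ((-1 : ℤ) ^ (n + 1) • (U.w ≫ S.map biprod.inl) + f.f (n + 1) ≫ κ.inv ≫ S.map biprod.inr)
    (U'.d n ≫ κ.inv ≫ S.map biprod.inr)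

/-- The axiom (F4), applied to right rotations: a commutative square on the last morphisms of two
angles extends to a morphism whose rotated cone is an angle. -/
theorem exists_hom_rotCone (hbox : IsAngulation S n box) [NeZero n] {U U' : PreSeq S n}
    (hU : U.InBox box) (hU' : U'.InBox box) (a : U.X 0 ⟶ U'.X 0) (c : U.X (n + 1) ⟶ U'.X (n + 1))
    (h : U.w ≫ S.map a = c ≫ U'.w) {V' : C} (v' : V' ⟶ U'.X 0) (κ' : S.obj V' ≅ U'.X (n + 1))
    (hv' : S.map v' = (-1 : ℤ) ^ n • κ'.hom ≫ U'.w) :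
    ∃ f : Hom U U', f.f 0 = a ∧ f.f (n + 1) = c ∧ (rotCone f v' κ').InBox box := by
  have := hbox.automorphism.additive
  have := hbox.automorphism.isEquivalence
  have hn : 0 < n := NeZero.pos n
  obtain ⟨V, v, κ, hv⟩ := exists_rightRot hbox U
  obtain ⟨b, hbS⟩ := S.map_surjective (κ.hom ≫ c ≫ κ'.inv)
  have hsq : v ≫ a = b ≫ v' := S.map_injective (by
    simp [hv, hv', hbS, h])
  obtain ⟨φ, h0, h1, W, hW, ⟨D⟩⟩ := exists_hom_cone hbox
    ((inBox_rightRot hbox U v κ hv).2 hU) ((inBox_rightRot hbox U' v' κ' hv').2 hU') b a hsq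
  have hgw : U.d n ≫ c = φ.f (n + 1) ≫ U'.d n := by
    have := φ.comm_w =≫ κ'.hom
    simpa [h0, hbS] using this
  obtain ⟨F, hF, hFn⟩ : ∃ F : Hom U U', (∀ i, i ≤ n → F.f i = φ.f (i + 1)) ∧ F.f (n + 1) = c := by
    let f : ∀ i, U.X i ⟶ U'.X i := Function.update (fun i => φ.f (i + 1)) (n + 1) c
    have hf (i : ℕ) (hi : i ≤ n) : f i = φ.f (i + 1) := Function.update_of_ne (by omega) _ _
    have hfn : f (n + 1) = c := Function.update_self _ _ _
    refine ⟨⟨f, fun i hi => ?_, ?_⟩, hf, hfn⟩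
    · rw [hf i hi]
      obtain hi' | rfl := Nat.lt_or_eq_of_le hi
      · rw [hf (i + 1) hi']
        exact φ.comm (i + 1) hi'
      · rw [hfn, hgw]
    · rw [hfn, hf 0 (by omega), h1, h]
  refine ⟨F, (hF 0 (by omega)).trans h1, hFn, ?_⟩
  -- the isomorphism from the cone of `φ` to the rotated cone of `F`
  let L : W.X (n + 1) ⟶ U.X (n + 1) ⊞ U'.X n := D.eLast.hom ≫ biprod.map κ.hom (𝟙 _)
  obtain ⟨ψ, hψ0, hψ, hψn⟩ : ∃ ψ : ∀ i, W.X i ⟶ (rotCone F v' κ').X i,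
      ψ 0 = (D.e 0 hn.le).hom ∧ (∀ j (hj : j + 1 ≤ n), ψ (j + 1) = (D.e (j + 1) hj).hom) ∧
        ψ (n + 1) = L :=
    ⟨fun i => match i with
      | 0 => (D.e 0 hn.le).hom
      | j + 1 => if hj : j + 1 ≤ n then (D.e (j + 1) hj).hom else
          if hj' : j = n then by subst hj'; exact L else 0,
      rfl, fun j hj => dif_pos hj, (dif_neg (by omega)).trans (dif_pos rfl)⟩
  obtain ⟨m, rfl⟩ : ∃ m, n = m + 1 := ⟨n - 1, by omega⟩
  refine InBox.of_iso hbox ⟨ψ, fun i hi => ?_, ?_⟩ (fun i hi => ?_) hW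
  · obtain hi' | rfl := Nat.lt_or_eq_of_le hi
    · rw [hψ i hi']
      cases i with
      | zero =>
        dsimp only
        rw [hψ0, hF 0 hi]
        exact D.comm 0 hi'
      | succ j =>
        rw [hψ j hi]
        dsimp only
        rw [hF (j + 1) hi]
        exact D.comm (j + 1) hi'
    · rw [hψn, hψ m hi]
      dsimp only [L]
      rw [reassoc_of% D.comm_last, ofComponents_map, hF (m + 1) hi]
      simp
  · rw [hψ0, hψn, D.comm_w]
    dsimp only [L]
    simp only [Category.assoc]
    refine congrArg (D.eLast.hom ≫ ·) (biprod.hom_ext' _ _ ?_ ?_)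
    · simp [hFn, h0, hv, hbS, pow_succ]
    · simp
  · cases i with
    | zero => dsimp only; rw [hψ0]; infer_instance
    | succ j =>
      obtain hi' | hi' := Nat.lt_or_eq_of_le hi
      · dsimp only
        rw [hψ j (by omega)]
        infer_instance
      · obtain rfl : j = m + 1 := by omega
        dsimp only
        rw [hψn]
        exact (D.eLast ≪≫ biprod.mapIso κ (Iso.refl _)).isIso_hom

end PreSeq

/-! ### Elementary angles -/

section

variable {C : Type u} [Category.{v} C] [Preadditive C] {S : C ⥤ C} {n : ℕ}

/-- The sequence `A ⟶ X¹ ⟶ ⋯ ⟶ Xⁿ ⟶ Z ⟶ S A` given by a complex `X` with end terms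
`A` and `Z` and a morphism `δ : Z ⟶ S A`. -/
abbrev EndedComplex.pre {A Z : C} (X : EndedComplex n A Z) (δ : Z ⟶ S.obj A) : PreSeq S n where
  X := X.K.X
  d i := X.K.d i (i + 1)
  w := X.right.hom ≫ δ ≫ S.map X.left.inv

variable [HasZeroObject C]

theorem EndedComplex.pre_inBox [HasBinaryBiproducts C] {box : Set (SSeq S n)}
    (hbox : IsAngulation S n box) {A Z : C} (X : EndedComplex n A Z) (δ : Z ⟶ S.obj A) :
    (X.pre δ).InBox box ↔ X.toSSeq δ ∈ box :=
  PreSeq.inBox_toPre hbox (X.toSSeq δ)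

theorem isIso_double_d {i : ℕ} (A : C) (h : (ComplexShape.up ℕ).Rel i (i + 1)) :
    IsIso ((HomologicalComplex.double (𝟙 A) h).d i (i + 1)) := by
  rw [HomologicalComplex.double_d _ _ (by omega)]
  infer_instance

instance isIso_trivLeft_d (n : ℕ) [NeZero n] (A : C) : IsIso ((trivLeft n A).K.d 0 1) :=
  isIso_double_d A rfl

instance isIso_trivRight_d (n : ℕ) [NeZero n] (A : C) : IsIso ((trivRight n A).K.d n (n + 1)) :=
  isIso_double_d A rfl

end

section Discs

variable {C : Type u} [Category.{v} C] [Preadditive C] [HasZeroObject C]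
  [HasBinaryBiproducts C] {S : C ⥤ C} {n : ℕ} {box : Set (SSeq S n)}

/-- A sequence `0 ⟶ ⋯ ⟶ 0 ⟶ A ≅ B ⟶ 0 ⟶ ⋯ ⟶ 0` is an angle: rotating it to the left
until the isomorphism is the first morphism leads to a trivial sequence. -/
theorem IsAngulation.mem_of_isZero_of_isIso (hbox : IsAngulation S n box) [NeZero n] (i : ℕ)
    (hi : i ≤ n) (Y : SSeq S n) (hY : ∀ j, j ≠ i → j ≠ i + 1 → IsZero (Y.X j))
    (hd : IsIso (Y.d i)) : Y ∈ box := by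
  have := hbox.automorphism.additive
  have hn : 0 < n := NeZero.pos n
  induction i generalizing Y with
  | zero =>
    refine hbox.mem_of_iso (X := trivialSSeq S n (Y.X 0)) ⟨fun i => match i with
        | 0 => 𝟙 _
        | 1 => Y.d 0
        | _ + 2 => 0, fun i => ?_, ?_⟩ (fun i _ => ?_) (hbox.trivial _)
    · match i with
      | 0 => rfl
      | i + 1 => exact (hY (i + 1 + 1) (by omega) (by omega)).eq_of_tgt _ _
    · obtain ⟨m, rfl⟩ : ∃ m, n = m + 1 := ⟨n - 1, by omega⟩
      exact (isZero_zero C).eq_of_src _ _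
    · match i with
      | 0 => exact inferInstanceAs (IsIso (𝟙 (Y.X 0)))
      | 1 => exact hd
      | i + 2 => exact ⟨0, (isZero_zero C).eq_of_src _ _,
          (hY _ (by omega) (by omega)).eq_of_src _ _⟩
  | succ i ih =>
    have h0 : IsZero (S.obj (Y.X 0)) := S.map_isZero (hY 0 (by omega) (by omega))
    have hz : IsZero (Y.X (n + 1 + 1)) := Y.isZero _ (by omega)
    let Y' : SSeq S n :=
      { X := fun j => Y.X (j + 1)
        d := fun j => Y.d (j + 1)
        w := 0
        isZero := fun j hj => Y.isZero _ (by omega) }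
    refine (hbox.rotate Y Y' ⟨?_⟩).2
      (ih (by omega) Y' (fun j h1 h2 => hY _ (by omega) (by omega)) hd)
    exact
      { e := fun j _ => Iso.refl _
        eLast := h0.iso hz
        comm := fun j hj => (Category.comp_id _).trans (Category.id_comp _).symm
        comm_last := hz.eq_of_tgt _ _
        comm_w := h0.eq_of_src _ _ }

theorem IsAngulation.trivLeft_mem (hbox : IsAngulation S n box) [NeZero n] (A : C)
    (δ : (0 : C) ⟶ S.obj A) : (trivLeft n A).toSSeq δ ∈ box :=
  hbox.mem_of_isZero_of_isIso 0 (Nat.zero_le _) _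
    (fun _ h1 h2 => HomologicalComplex.isZero_double_X (c := ComplexShape.up ℕ) (𝟙 A) rfl _ h1 h2)
    (isIso_trivLeft_d n A)

theorem IsAngulation.trivRight_mem (hbox : IsAngulation S n box) [NeZero n] (A : C)
    (δ : A ⟶ S.obj (0 : C)) : (trivRight n A).toSSeq δ ∈ box :=
  hbox.mem_of_isZero_of_isIso n le_rfl _
    (fun _ h1 h2 => HomologicalComplex.isZero_double_X (c := ComplexShape.up ℕ) (𝟙 A) rfl _ h1 h2)
    (isIso_trivRight_d n A)

end Discs

/-! ### Exactness of angles -/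

section Exactness

/-- `f` is a weak kernel of `g`. -/
def IsWeakKernel {C : Type u} [Category.{v} C] [Preadditive C] {A B D : C} (f : A ⟶ B)
    (g : B ⟶ D) : Prop :=
  f ≫ g = 0 ∧ ∀ ⦃Q : C⦄ (x : Q ⟶ B), x ≫ g = 0 → ∃ y, y ≫ f = x

/-- `g` is a weak cokernel of `f`. -/
def IsWeakCokernel {C : Type u} [Category.{v} C] [Preadditive C] {A B D : C} (f : A ⟶ B)
    (g : B ⟶ D) : Prop :=
  f ≫ g = 0 ∧ ∀ ⦃Q : C⦄ (x : B ⟶ Q), f ≫ x = 0 → ∃ y, g ≫ y = x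

theorem zsmul_neg_one_pow_eq_zero {C : Type u} [Category.{v} C] [Preadditive C] {n : ℕ} {A B : C}
    {f : A ⟶ B} (h : (-1 : ℤ) ^ n • f = 0) : f = 0 := by
  have := congrArg ((-1 : ℤ) ^ n • ·) h
  simpa [smul_smul, ← mul_pow] using this

namespace PreSeq

variable {C : Type u} [Category.{v} C] [Preadditive C] [HasZeroObject C]
  [HasBinaryBiproducts C] {S : C ⥤ C} {n : ℕ} {box : Set (SSeq S n)}

/-- A property of pairs of composable morphisms which holds for the last two morphisms of every
angle holds, by rotation, for all pairs of consecutive morphisms. -/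
theorem InBox.of_last (hbox : IsAngulation S n box) [NeZero n]
    {P : ∀ {A B D : C}, (A ⟶ B) → (B ⟶ D) → Prop}
    (hP : ∀ {A B D D' : C} (f : A ⟶ B) (g : B ⟶ D) (e : D ≅ D'), P f (g ≫ e.hom) → P f g)
    (h : ∀ U : PreSeq S n, U.InBox box → P (U.d n) U.w)
    {U : PreSeq S n} (hU : U.InBox box) {i : ℕ} (hi : i < n) : P (U.d i) (U.d (i + 1)) := by
  obtain ⟨m, hm⟩ : ∃ m, i + 1 + m = n := ⟨n - (i + 1), by omega⟩
  induction m generalizing i U with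
  | zero =>
    obtain ⟨V, v, κ, hv⟩ := exists_rightRot hbox U
    have := h _ ((inBox_rightRot hbox U v κ hv).2 hU)
    obtain rfl : i + 1 = n := hm
    exact hP _ _ κ.symm this
  | succ m ih =>
    obtain ⟨V, v, κ, hv⟩ := exists_rightRot hbox U
    exact ih ((inBox_rightRot hbox U v κ hv).2 hU) (i := i + 1) (by omega) (by omega)

/-- A property of pairs of composable morphisms which holds for `(w, S d⁰)` in every
angle holds, by rotation, for the last two morphisms of every angle. -/
theorem InBox.last_of_w (hbox : IsAngulation S n box)
    {P : ∀ {A B D : C}, (A ⟶ B) → (B ⟶ D) → Prop}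
    (hP : ∀ {A B B' D : C} (f : A ⟶ B) (g : B ⟶ D) (e : B' ≅ B),
      P (f ≫ e.inv) ((-1 : ℤ) ^ n • e.hom ≫ g) → P f g)
    (h : ∀ U : PreSeq S n, U.InBox box → P U.w (S.map (U.d 0)))
    {U : PreSeq S n} (hU : U.InBox box) : P (U.d n) U.w := by
  obtain ⟨V, v, κ, hv⟩ := exists_rightRot hbox U
  have := h _ ((inBox_rightRot hbox U v κ hv).2 hU)
  refine hP _ _ κ ?_
  rw [← hv]
  exact this

theorem InBox.w_map_d (hbox : IsAngulation S n box) [NeZero n] {U : PreSeq S n}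
    (hU : U.InBox box) : U.w ≫ S.map (U.d 0) = 0 := by
  have := hbox.automorphism.additive
  obtain ⟨V, v, κ, hv⟩ := exists_rightRot hbox U
  -- compare the trivial sequence on `V` with the right rotation of `U`
  obtain ⟨φ, h0, h1, -⟩ := exists_hom_cone hbox ((inBox_toPre hbox _).2 (hbox.trivial V))
    ((inBox_rightRot hbox U v κ hv).2 hU) (𝟙 V) v rfl
  have h2 := φ.comm 1 (NeZero.pos n)
  rw [h1] at h2
  have h3 : v ≫ U.d 0 = 0 := h2.symm.trans zero_comp
  have h4 : (-1 : ℤ) ^ n • (κ.hom ≫ U.w ≫ S.map (U.d 0)) = 0 := by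
    rw [← S.map_zero, ← h3, S.map_comp, hv]
    simp
  rw [← cancel_epi κ.hom, zsmul_neg_one_pow_eq_zero h4, comp_zero]

theorem InBox.d_w (hbox : IsAngulation S n box) [NeZero n] {U : PreSeq S n}
    (hU : U.InBox box) : U.d n ≫ U.w = 0 :=
  InBox.last_of_w hbox (P := fun f g => f ≫ g = 0)
    (fun f g e h => zsmul_neg_one_pow_eq_zero (n := n) (by simpa using h))
    (fun U hU => hU.w_map_d hbox) hU

theorem InBox.d_d (hbox : IsAngulation S n box) [NeZero n] {U : PreSeq S n}
    (hU : U.InBox box) {i : ℕ} (hi : i < n) : U.d i ≫ U.d (i + 1) = 0 :=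
  InBox.of_last hbox (P := fun f g => f ≫ g = 0)
    (fun f g e h => by rwa [← Category.assoc, Preadditive.IsIso.comp_right_eq_zero] at h)
    (fun U hU => hU.d_w hbox) hU hi

/-- The `n + 1`-st morphism of an angle is a weak kernel of the last one: lift a morphism `Q ⟶ Xⁿ⁺¹`
to a morphism from the angle `0 ⟶ ⋯ ⟶ 0 ⟶ Q = Q`. -/
theorem InBox.isWeakKernel_w (hbox : IsAngulation S n box) [NeZero n] {U : PreSeq S n}
    (hU : U.InBox box) : IsWeakKernel (U.d n) U.w := by
  have := hbox.automorphism.additive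
  refine ⟨hU.d_w hbox, fun Q x hx => ?_⟩
  obtain ⟨V, v, κ, hv⟩ := exists_rightRot hbox U
  obtain ⟨f, -, hf, -⟩ := exists_hom_rotCone hbox
    (((trivRight n Q).pre_inBox hbox 0).2 (hbox.trivRight_mem Q 0)) hU 0
    ((trivRight n Q).right.hom ≫ x) (by simp [hx]) v κ hv
  have h := f.comm n le_rfl
  rw [hf] at h
  refine ⟨(trivRight n Q).right.inv ≫ inv ((trivRight n Q).K.d n (n + 1)) ≫ f.f n, ?_⟩
  rw [Category.assoc, Category.assoc, ← h, IsIso.inv_hom_id_assoc, Iso.inv_hom_id_assoc]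

theorem InBox.isWeakKernel_d (hbox : IsAngulation S n box) [NeZero n] {U : PreSeq S n}
    (hU : U.InBox box) {i : ℕ} (hi : i < n) : IsWeakKernel (U.d i) (U.d (i + 1)) :=
  InBox.of_last hbox (P := fun f g => IsWeakKernel f g)
    (fun f g e h => ⟨by simpa [← Category.assoc] using h.1, fun Q x hx =>
      h.2 x (by rw [reassoc_of% hx, zero_comp])⟩)
    (fun U hU => hU.isWeakKernel_w hbox) hU hi

/-- `S d⁰` is a weak cokernel of the last morphism of an angle: extend a morphism `X⁰ ⟶ Q` to
a morphism to the angle `Q = Q ⟶ 0 ⟶ ⋯ ⟶ 0`. -/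
theorem InBox.isWeakCokernel_map_d (hbox : IsAngulation S n box) [NeZero n] {U : PreSeq S n}
    (hU : U.InBox box) : IsWeakCokernel U.w (S.map (U.d 0)) := by
  have := hbox.automorphism.additive
  have := hbox.automorphism.isEquivalence
  refine ⟨hU.w_map_d hbox, fun Q' x' hx' => ?_⟩
  obtain ⟨x, hx⟩ := S.map_surjective (x' ≫ (S.objObjPreimageIso Q').inv)
  have hwx : U.w ≫ S.map x = 0 := by rw [hx, reassoc_of% hx', zero_comp]
  let T := trivLeft n (S.objPreimage Q')
  obtain ⟨V, v, κ, hv⟩ := exists_rightRot hbox (T.pre (S := S) 0)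
  obtain ⟨f, hf, -, -⟩ := exists_hom_rotCone hbox hU
    ((T.pre_inBox hbox 0).2 (hbox.trivLeft_mem _ 0)) (x ≫ T.left.inv) 0
    (by rw [S.map_comp, reassoc_of% hwx]; simp) v κ hv
  have h := f.comm 0 (Nat.zero_le _)
  rw [hf, Category.assoc] at h
  have h' : U.d 0 ≫ f.f 1 ≫ inv (T.K.d 0 1) ≫ T.left.hom = x := by
    rw [reassoc_of% h, IsIso.hom_inv_id_assoc, Iso.inv_hom_id, Category.comp_id]
  refine ⟨S.map (f.f 1 ≫ inv (T.K.d 0 1) ≫ T.left.hom) ≫ (S.objObjPreimageIso Q').hom, ?_⟩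
  rw [← S.map_comp_assoc, h', hx, Category.assoc, Iso.inv_hom_id, Category.comp_id]

theorem InBox.isWeakCokernel_w (hbox : IsAngulation S n box) [NeZero n] {U : PreSeq S n}
    (hU : U.InBox box) : IsWeakCokernel (U.d n) U.w := by
  refine InBox.last_of_w hbox (P := fun f g => IsWeakCokernel f g) (fun f g e h => ?_)
    (fun U hU => hU.isWeakCokernel_map_d hbox) hU
  refine ⟨zsmul_neg_one_pow_eq_zero (n := n) (by simpa using h.1), fun Q x hx => ?_⟩
  obtain ⟨y, hy⟩ := h.2 (e.hom ≫ x) (by simpa using hx)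
  refine ⟨(-1 : ℤ) ^ n • y, ?_⟩
  rw [← cancel_epi e.hom, ← hy]
  simp

theorem InBox.isWeakCokernel_d (hbox : IsAngulation S n box) [NeZero n] {U : PreSeq S n}
    (hU : U.InBox box) {i : ℕ} (hi : i < n) : IsWeakCokernel (U.d i) (U.d (i + 1)) :=
  InBox.of_last hbox (P := fun f g => IsWeakCokernel f g)
    (fun f g e h => ⟨by simpa [← Category.assoc] using h.1, fun Q x hx => by
      obtain ⟨y, hy⟩ := h.2 x hx
      exact ⟨e.hom ≫ y, by rw [← hy, Category.assoc]⟩⟩)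
    (fun U hU => hU.isWeakCokernel_w hbox) hU hi

/-- Every morphism is the `k`-th morphism of an angle. -/
theorem exists_inBox_d (hbox : IsAngulation S n box) [NeZero n] {A B : C} (f : A ⟶ B) (k : ℕ) :
    ∃ U : PreSeq S n, U.InBox box ∧ ∃ (e : U.X k ≅ A) (e' : U.X (k + 1) ≅ B),
      U.d k ≫ e'.hom = e.hom ≫ f := by
  induction k with
  | zero =>
    obtain ⟨X, hX, e, e', h⟩ := hbox.complete f
    exact ⟨X.toPre, (inBox_toPre hbox X).2 hX, e, e', h⟩
  | succ k ih =>
    obtain ⟨U, hU, e, e', h⟩ := ih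
    obtain ⟨V, v, κ, hv⟩ := exists_rightRot hbox U
    exact ⟨U.rightRot v κ, (inBox_rightRot hbox U v κ hv).2 hU, e, e', h⟩

/-- Every morphism `δ : Z ⟶ S A` is the last morphism of an angle. -/
theorem exists_inBox_w (hbox : IsAngulation S n box) [NeZero n] {A Z : C} (δ : Z ⟶ S.obj A) :
    ∃ U : PreSeq S n, U.InBox box ∧ ∃ (e₀ : U.X 0 ≅ A) (e : U.X (n + 1) ≅ Z),
      U.w ≫ S.map e₀.hom = e.hom ≫ δ := by
  have := hbox.automorphism.isEquivalence
  obtain ⟨U, hU, e, e', h⟩ := exists_inBox_d hbox δ n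
  obtain ⟨v, hv⟩ := S.map_surjective ((-1 : ℤ) ^ n • e'.symm.hom ≫ U.w)
  refine ⟨U.rightRot v e'.symm, (inBox_rightRot hbox U v e'.symm hv).2 hU, Iso.refl _, e, ?_⟩
  simpa using h

end PreSeq

end Exactness

/-! ### Realizations given by angles -/

section Realization

variable {C : Type u} [Category.{v} C] [Preadditive C] {S : C ⥤ C} {n : ℕ}

/-- The morphism of sequences given by a morphism of complexes. -/
abbrev preHom {A Z A' Z' : C} {X : EndedComplex n A Z} {Y : EndedComplex n A' Z'}
    {δ : Z ⟶ S.obj A} {ρ : Z' ⟶ S.obj A'} (f : X.K ⟶ Y.K)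
    (hw : (X.pre δ).w ≫ S.map (f.f 0) = f.f (n + 1) ≫ (Y.pre ρ).w) :
    PreSeq.Hom (X.pre δ) (Y.pre ρ) where
  f := f.f
  comm i _ := (f.comm i (i + 1)).symm
  comm_w := hw

/-- A morphism of the sequences given by two complexes is a morphism of complexes. -/
theorem exists_eq_preHom {A Z A' Z' : C} {X : EndedComplex n A Z} {Y : EndedComplex n A' Z'}
    {δ : Z ⟶ S.obj A} {ρ : Z' ⟶ S.obj A'} (F : PreSeq.Hom (X.pre δ) (Y.pre ρ)) :
    ∃ (f : X.K ⟶ Y.K) (hw : _), F = preHom f hw := by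
  refine ⟨⟨F.f, ?_⟩, F.comm_w, rfl⟩
  rintro i _ rfl
  by_cases hi : i ≤ n
  · exact (F.comm i hi).symm
  · exact (Y.isZero _ (by omega)).eq_of_tgt _ _

/-- A morphism of complexes indexed by `ℕ` is null homotopic if its components are given by a
family `h` in the usual way. -/
theorem exists_homotopy_zero {K L : CochainComplex C ℕ} (f : K ⟶ L)
    (h : ∀ i, K.X (i + 1) ⟶ L.X i) (h0 : f.f 0 = K.d 0 1 ≫ h 0)
    (hs : ∀ i, f.f (i + 1) = K.d (i + 1) (i + 2) ≫ h (i + 1) + h i ≫ L.d i (i + 1)) :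
    Nonempty (Homotopy f 0) := by
  let h' : ∀ i j, (ComplexShape.up ℕ).Rel j i → (K.X i ⟶ L.X j) := fun i j hij =>
    eqToHom (by obtain rfl := hij; rfl) ≫ h j
  refine ⟨(Homotopy.ofEq ?_).trans (Homotopy.nullHomotopy' h')⟩
  ext i
  cases i with
  | zero =>
    rw [Homotopy.nullHomotopicMap'_f_of_not_rel_right (k₁ := 0) (k₀ := 1) rfl (by simp), h0]
    simp [h']
  | succ i =>
    rw [Homotopy.nullHomotopicMap'_f (k₂ := i) (k₁ := i + 1) (k₀ := i + 2) rfl rfl, hs]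
    simp [h']

variable [HasZeroObject C] [HasBinaryBiproducts C] {box : Set (SSeq S n)}

/-- Angles give `n`-exangles. -/
theorem IsAngulation.isNExangle (hbox : IsAngulation S n box) [NeZero n] {A Z : C}
    (X : EndedComplex n A Z) (δ : Z ⟶ S.obj A) (hX : X.toSSeq δ ∈ box) :
    IsNExangle (E := ESigma S) X δ := by
  have := hbox.automorphism.additive
  have := hbox.automorphism.isEquivalence
  have hU := (X.pre_inBox hbox δ).2 hX
  constructor
  · refine fun Q i hi x => ⟨fun hx => (hU.isWeakKernel_d hbox hi).2 x hx, ?_⟩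
    rintro ⟨y, rfl⟩
    simp
  · refine fun Q x => ⟨fun hx => ?_, ?_⟩
    · have hx' : x ≫ δ = 0 := hx
      obtain ⟨y, hy⟩ := (hU.isWeakKernel_w hbox).2 (x ≫ X.right.inv) (by
        simp [reassoc_of% hx'])
      refine ⟨y, ?_⟩
      dsimp only at hy
      simp [EndedComplex.dLast, reassoc_of% hy]
    · rintro ⟨y, rfl⟩
      have := (hU.d_w hbox) =≫ S.map X.left.hom
      simp only [Category.assoc, ← S.map_comp, Iso.inv_hom_id, S.map_id, zero_comp,
        Category.comp_id] at this
      change (y ≫ X.dLast) ≫ δ = 0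
      simp [EndedComplex.dLast, this]
  · refine fun Q i hi x => ⟨fun hx => (hU.isWeakCokernel_d hbox hi).2 x hx, ?_⟩
    rintro ⟨y, rfl⟩
    simp
  · refine fun Q x => ⟨fun hx => ?_, ?_⟩
    · have hx' : δ ≫ S.map x = 0 := hx
      obtain ⟨y', hy'⟩ := (hU.isWeakCokernel_map_d hbox).2 (S.map (X.left.hom ≫ x)) (by
        simp only [Category.assoc, ← S.map_comp, Iso.inv_hom_id_assoc, hx', comp_zero])
      obtain ⟨y, rfl⟩ := S.map_surjective y'
      rw [← S.map_comp] at hy'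
      refine ⟨y, ?_⟩
      simp [EndedComplex.dFirst, S.map_injective hy']
    · rintro ⟨y, rfl⟩
      have := X.right.inv ≫= hU.w_map_d hbox
      simp only [Category.assoc, Iso.inv_hom_id_assoc, ← S.map_comp, comp_zero] at this
      change δ ≫ S.map (X.dFirst ≫ y) = 0
      rw [S.map_comp, EndedComplex.dFirst, reassoc_of% this, zero_comp]

/-- Every morphism of extensions lifts to a morphism of complexes whose rotated cone is an
angle. -/
theorem IsAngulation.exists_lift (hbox : IsAngulation S n box) [NeZero n] {A Z A' Z' : C}
    {X : EndedComplex n A Z} {Y : EndedComplex n A' Z'} {δ : Z ⟶ S.obj A} {ρ : Z' ⟶ S.obj A'}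
    (hX : X.toSSeq δ ∈ box) (hY : Y.toSSeq ρ ∈ box) (a : A ⟶ A') (c : Z ⟶ Z')
    (h : δ ≫ S.map a = c ≫ ρ) :
    ∃ f : X.K ⟶ Y.K, HasEnds (X := X) (Y := Y) f a c ∧
      ∃ (hw : (X.pre δ).w ≫ S.map (f.f 0) = f.f (n + 1) ≫ (Y.pre ρ).w)
        (V : C) (v : V ⟶ Y.K.X 0) (κ : S.obj V ≅ Y.K.X (n + 1)),
        S.map v = (-1 : ℤ) ^ n • κ.hom ≫ (Y.pre ρ).w ∧
          (PreSeq.rotCone (preHom f hw) v κ).InBox box := by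
  obtain ⟨V, v, κ, hv⟩ := PreSeq.exists_rightRot hbox (Y.pre ρ)
  obtain ⟨F, h0, h1, hF⟩ := PreSeq.exists_hom_rotCone hbox ((X.pre_inBox hbox δ).2 hX)
    ((Y.pre_inBox hbox ρ).2 hY) (X.left.hom ≫ a ≫ Y.left.inv) (X.right.hom ≫ c ≫ Y.right.inv)
    (by simp only [Category.assoc, ← S.map_comp, Iso.inv_hom_id_assoc]; simp [reassoc_of% h])
    v κ hv
  obtain ⟨f, hw, rfl⟩ := exists_eq_preHom F
  refine ⟨f, ⟨?_, ?_⟩, hw, V, v, κ, hv, hF⟩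
  · rw [show f.f 0 = _ from h0]; simp
  · rw [show f.f (n + 1) = _ from h1]; simp

/-- If an endomorphism of an angle vanishes in degrees `0` and `n + 1`, then its square is null
homotopic. The endomorphism itself need not be: the exactness of the angle yields a homotopy `h`
that is correct in degrees `≤ n` only. -/
theorem IsAngulation.exists_homotopy_sq (hbox : IsAngulation S n box) [NeZero n] {A Z : C}
    (X : EndedComplex n A Z) (δ : Z ⟶ S.obj A) (hX : X.toSSeq δ ∈ box) (θ : X.K ⟶ X.K)
    (h0 : θ.f 0 = 0) (h1 : θ.f (n + 1) = 0) : Nonempty (Homotopy (θ ≫ θ) 0) := by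
  have hU := (X.pre_inBox hbox δ).2 hX
  have key : ∀ k, k ≤ n → ∃ h : ∀ i, X.K.X (i + 1) ⟶ X.K.X i, h 0 = 0 ∧ ∀ i, i < k →
      θ.f (i + 1) = X.K.d (i + 1) (i + 2) ≫ h (i + 1) + h i ≫ X.K.d i (i + 1) := by
    intro k hk
    induction k with
    | zero => exact ⟨fun _ => 0, rfl, fun i hi => absurd hi (by omega)⟩
    | succ k ih =>
      obtain ⟨h, hz, hh⟩ := ih (by omega)
      have hd : X.K.d k (k + 1) ≫ (θ.f (k + 1) - h k ≫ X.K.d k (k + 1)) = 0 := by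
        rw [Preadditive.comp_sub, ← θ.comm]
        cases k with
        | zero => simp [hz, h0]
        | succ k => simp [hh k (by omega)]
      obtain ⟨y, hy⟩ := (hU.isWeakCokernel_d hbox (i := k) (by omega)).2 _ hd
      dsimp only at hy
      refine ⟨Function.update h (k + 1) y, ?_, fun i hi => ?_⟩
      · rw [Function.update_of_ne (by omega), hz]
      · obtain hi' | rfl := Nat.lt_succ_iff_lt_or_eq.1 hi
        · rw [Function.update_of_ne (by omega), Function.update_of_ne (by omega), hh i hi']
        · rw [Function.update_self, Function.update_of_ne (by omega), hy]
          abel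
  obtain ⟨h, hz, hh⟩ := key n le_rfl
  refine exists_homotopy_zero _ (fun i => θ.f (i + 1) ≫ h i) (by simp [hz, h0]) fun i => ?_
  by_cases hi : i < n
  · rw [HomologicalComplex.comp_f]
    nth_rw 2 [hh i hi]
    rw [Preadditive.comp_add, ← θ.comm_assoc, Category.assoc]
  · obtain rfl | hi' := (Nat.le_of_not_lt hi).eq_or_lt
    · have := (X.isZero (n + 2) (by omega)).eq_of_tgt (X.K.d (n + 1) (n + 2)) 0
      simp [h1, this]
    · exact (X.isZero (i + 1) (by omega)).eq_of_tgt _ _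

/-- The homotopy class of an angle with last morphism `δ` depends on `δ` only. If `f` and `g` are
lifts in both directions, then `f ≫ g = 1 + θ` with `θ²` null homotopic, so that `g ≫ (1 - θ)` is a
right inverse of `f` up to homotopy; similarly, `f` has a left inverse. -/
theorem IsAngulation.htpyEquivalent (hbox : IsAngulation S n box) [NeZero n] {A Z : C}
    (X Y : EndedComplex n A Z) (δ : Z ⟶ S.obj A) (hX : X.toSSeq δ ∈ box)
    (hY : Y.toSSeq δ ∈ box) : HtpyEquivalent X Y := by
  obtain ⟨f, hf, -⟩ := hbox.exists_lift hX hY (𝟙 A) (𝟙 Z) (by simp)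
  obtain ⟨g, hg, -⟩ := hbox.exists_lift hY hX (𝟙 A) (𝟙 Z) (by simp)
  have aux {X : EndedComplex n A Z} (hX : X.toSSeq δ ∈ box) (e : X.K ⟶ X.K)
      (he : HasEnds (X := X) (Y := X) e (𝟙 A) (𝟙 Z)) :
      ∃ t : X.K ⟶ X.K, HasEnds (X := X) (Y := X) t (𝟙 A) (𝟙 Z) ∧
        Nonempty (Homotopy (e ≫ t) (𝟙 _)) ∧ Nonempty (Homotopy (t ≫ e) (𝟙 _)) := by
    have h0 : e.f 0 = 𝟙 _ := by
      rw [← cancel_mono X.left.hom, he.1]; simp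
    have h1 : e.f (n + 1) = 𝟙 _ := by
      rw [← cancel_mono X.right.hom, he.2]; simp
    obtain ⟨H⟩ := hbox.exists_homotopy_sq X δ hX (e - 𝟙 _) (by simp [h0]) (by simp [h1])
    refine ⟨𝟙 _ - (e - 𝟙 _), ⟨by simp [h0], by simp [h1]⟩, ⟨?_⟩, ⟨?_⟩⟩
    · refine Homotopy.symm ((Homotopy.equivSubZero (f := 𝟙 _) (g := _)).symm ?_)
      exact (Homotopy.ofEq (by simp; abel)).trans H
    · refine Homotopy.symm ((Homotopy.equivSubZero (f := 𝟙 _) (g := _)).symm ?_)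
      exact (Homotopy.ofEq (by simp; abel)).trans H
  obtain ⟨t, ht, ⟨H1⟩, -⟩ := aux hX (f ≫ g) (by simpa using hf.comp hg)
  obtain ⟨t', ht', -, ⟨H2⟩⟩ := aux hY (g ≫ f) (by simpa using hg.comp hf)
  -- `g ≫ t` is a right inverse and `t' ≫ g` is a left inverse of `f`
  have H1' : Homotopy (f ≫ g ≫ t) (𝟙 _) := (Homotopy.ofEq (by simp)).trans H1
  have H2' : Homotopy ((t' ≫ g) ≫ f) (𝟙 _) := (Homotopy.ofEq (by simp)).trans H2
  have H3 : Homotopy (g ≫ t) (t' ≫ g) :=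
    ((Homotopy.ofEq (by simp)).trans (H2'.symm.compRight (g ≫ t))).trans
      ((Homotopy.ofEq (by simp)).trans ((H1'.compLeft (t' ≫ g)).trans (Homotopy.ofEq (by simp))))
  exact ⟨⟨f, g ≫ t, H1', (H3.compRight f).trans H2'⟩, hf, by simpa using hg.comp ht⟩

end Realization

/-! ### Contractible angles and invariance under homotopy equivalence -/

namespace PreSeq

section

variable {C : Type u} [Category.{v} C] [Preadditive C] [HasBinaryBiproducts C] {S : C ⥤ C} {n : ℕ}

/-- The degreewise direct sum of two sequences. -/
noncomputable abbrev biprod (U V : PreSeq S n) : PreSeq S n where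
  X i := U.X i ⊞ V.X i
  d i := biprod.map (U.d i) (V.d i)
  w := biprod.desc (U.w ≫ S.map biprod.inl) (V.w ≫ S.map biprod.inr)

/-- The degreewise direct sum is a direct sum of sequences. -/
noncomputable def biprodDirectSum [S.Additive] (U V : PreSeq S n) :
    DirectSum U V (U.biprod V) where
  inl := ⟨fun i => biprod.inl, fun i _ => by simp, by simp⟩
  inr := ⟨fun i => biprod.inr, fun i _ => by simp, by simp⟩
  fst := ⟨fun i => biprod.fst, fun i _ => by simp, by
    refine biprod.hom_ext' _ _ ?_ ?_ <;> simp [← S.map_comp]⟩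
  snd := ⟨fun i => biprod.snd, fun i _ => by simp, by
    refine biprod.hom_ext' _ _ ?_ ?_ <;> simp [← S.map_comp]⟩
  inl_fst i _ := by simp
  inr_snd i _ := by simp
  inl_snd i _ := by simp
  inr_fst i _ := by simp
  total i _ := by simp [biprod.total]

/-- The direct sum of the elementary sequences `0 ⟶ ⋯ ⟶ Bᵢ = Bᵢ ⟶ ⋯ ⟶ 0`, with `Bᵢ` in degrees
`i` and `i + 1` for `i ≤ n`, and of the rotated one with `Bₙ₊₁` in degree `n + 1` and `V` in
degree `0`, where `S V = Bₙ₊₁`. -/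
noncomputable abbrev contractible (B : ℕ → C) {V : C} (κ : S.obj V ≅ B (n + 1)) : PreSeq S n where
  X i := match i with
    | 0 => B 0 ⊞ V
    | j + 1 => B (j + 1) ⊞ B j
  d i := match i with
    | 0 => biprod.lift 0 biprod.fst
    | _ + 1 => biprod.lift 0 biprod.fst
  w := biprod.fst ≫ κ.inv ≫ S.map biprod.inr

end

variable {C : Type u} [Category.{v} C] [Preadditive C] [HasZeroObject C]
  [HasBinaryBiproducts C] {S : C ⥤ C} {n : ℕ}

/-- The family `B` with `B 0` replaced by zero. -/
noncomputable abbrev dropZero (B : ℕ → C) : ℕ → C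
  | 0 => 0
  | i + 1 => B (i + 1)

/-- The trivial sequence `A = A ⟶ 0 ⟶ ⋯ ⟶ 0 ⟶ S A`. -/
noncomputable abbrev trivialPre (S : C ⥤ C) (n : ℕ) (A : C) : PreSeq S n where
  X i := match i with
    | 0 => A
    | 1 => A
    | _ + 2 => 0
  d i := match i with
    | 0 => 𝟙 A
    | _ + 1 => 0
  w := 0

/-- The family `B`, shifted by one. -/
abbrev shiftFamily (B : ℕ → C) : ℕ → C := fun i => B (i + 1)

/-- Splitting off the first elementary sequence. -/
noncomputable def contractibleDirectSum [S.Additive] [NeZero n] (B : ℕ → C) {V : C}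
    (κ : S.obj V ≅ B (n + 1)) : DirectSum (trivialPre S n (B 0))
      (contractible (dropZero B) (n := n) κ) (contractible B κ) where
  inl := ⟨fun i => match i with
      | 0 => biprod.inl
      | 1 => biprod.inr
      | _ + 2 => 0, fun i _ => by
        match i with
        | 0 => ext <;> simp
        | 1 => ext <;> simp
        | i + 2 => simp, by
      obtain ⟨m, rfl⟩ : ∃ m, n = m + 1 := ⟨n - 1, by have := NeZero.pos n; omega⟩
      simp⟩
  inr := ⟨fun i => match i with
      | 0 => biprod.map 0 (𝟙 V)
      | 1 => biprod.map (𝟙 _) 0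
      | _ + 2 => 𝟙 _, fun i _ => by
        match i with
        | 0 => ext <;> simp
        | 1 => ext <;> simp
        | i + 2 => simp, by
      obtain ⟨m, rfl⟩ : ∃ m, n = m + 1 := ⟨n - 1, by have := NeZero.pos n; omega⟩
      simp [← S.map_comp]⟩
  fst := ⟨fun i => match i with
      | 0 => biprod.fst
      | 1 => biprod.snd
      | _ + 2 => 0, fun i _ => by
        match i with
        | 0 => simp
        | 1 => simp
        | i + 2 => simp, by
      obtain ⟨m, rfl⟩ : ∃ m, n = m + 1 := ⟨n - 1, by have := NeZero.pos n; omega⟩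
      simp [← S.map_comp]⟩
  snd := ⟨fun i => match i with
      | 0 => biprod.map 0 (𝟙 V)
      | 1 => biprod.map (𝟙 _) 0
      | _ + 2 => 𝟙 _, fun i _ => by
        match i with
        | 0 => ext <;> simp
        | 1 => ext <;> simp
        | i + 2 => simp, by
      obtain ⟨m, rfl⟩ : ∃ m, n = m + 1 := ⟨n - 1, by have := NeZero.pos n; omega⟩
      simp [← S.map_comp]⟩
  inl_fst i _ := by
    match i with
    | 0 => simp
    | 1 => simp
    | i + 2 => simp
  inr_snd i _ := by
    match i with
    | 0 => (ext; simp)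
    | 1 => (ext; simp)
    | i + 2 => simp
  inl_snd i _ := by
    match i with
    | 0 => simp
    | 1 => simp
    | i + 2 => simp
  inr_fst i _ := by
    match i with
    | 0 => simp
    | 1 => simp
    | i + 2 => simp
  total i _ := by
    match i with
    | 0 => ext <;> simp
    | 1 => ext <;> simp
    | i + 2 => simp

variable {box : Set (SSeq S n)}

theorem trivialPre_inBox (hbox : IsAngulation S n box) (A : C) :
    (trivialPre S n A).InBox box := by
  have h : (trivialPre S n A) = (trivialSSeq S n A).toPre := rfl
  rw [h]
  exact (inBox_toPre hbox _).2 (hbox.trivial A)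

theorem contractible_inBox (hbox : IsAngulation S n box) [NeZero n] (k : ℕ) (hk : k ≤ n + 2)
    (B : ℕ → C) (hB : ∀ i, k ≤ i → IsZero (B i)) {V : C} (κ : S.obj V ≅ B (n + 1)) :
    (contractible B κ).InBox box := by
  have := hbox.automorphism.additive
  have := hbox.automorphism.isEquivalence
  obtain ⟨m, hm⟩ : ∃ m, n = m + 1 := ⟨n - 1, by have := NeZero.pos n; omega⟩
  induction k generalizing B V with
  | zero =>
    -- all terms vanish
    have hV : IsZero V := by
      rw [IsZero.iff_id_eq_zero]
      exact S.map_injective (((hB _ (by omega)).of_iso κ).eq_of_src _ _)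
    have hz : ∀ i, IsZero ((contractible B κ).X i) := fun i => match i with
      | 0 => (biprod_isZero_iff _ _).2 ⟨hB _ (by omega), hV⟩
      | j + 1 => (biprod_isZero_iff _ _).2 ⟨hB _ (by omega), hB _ (by omega)⟩
    have hz' : ∀ i, IsZero ((trivialPre S n (0 : C)).X i) := fun i => match i with
      | 0 => isZero_zero C
      | 1 => isZero_zero C
      | j + 2 => isZero_zero C
    exact InBox.of_iso hbox ⟨fun i => 0, fun i _ => by simp, by simp⟩
      (fun i _ => ⟨0, (hz' i).eq_of_src _ _, (hz i).eq_of_src _ _⟩) (trivialPre_inBox hbox 0)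
  | succ k ih =>
    refine ((contractibleDirectSum B κ).inBox_iff hbox).2 ⟨trivialPre_inBox hbox _, ?_⟩
    -- the remaining summand is a right rotation of the sequence for the shifted family
    have hz : IsZero (shiftFamily B (n + 1)) := hB _ hk
    let κ' : S.obj (0 : C) ≅ shiftFamily B (n + 1) := (S.map_isZero (isZero_zero C)).iso hz
    have hQ := ih (by omega) (shiftFamily B) (fun i hi => hB _ (by omega)) κ'
    let κ'' : S.obj V ≅ B (n + 2) ⊞ B (n + 1) :=
      { hom := κ.hom ≫ biprod.inr
        inv := biprod.snd ≫ κ.inv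
        inv_hom_id := by
          refine biprod.hom_ext' _ _ (hz.eq_of_src _ _) ?_
          simp }
    have hR := (inBox_rightRot hbox (contractible (shiftFamily B) κ') (0 : V ⟶ _) κ''
      (by simp [κ''])).2 hQ
    refine InBox.of_iso hbox (U := (contractible (shiftFamily B) κ').rightRot 0 κ'')
      (V := contractible (dropZero B) κ) ⟨fun i => match i with
      | 0 => biprod.inr
      | 1 => 𝟙 _
      | j + 2 => 𝟙 _, fun i _ => ?_, ?_⟩ (fun i _ => ?_) hR
    · match i with
      | 0 => ext <;> simp
      | 1 => simp
      | j + 2 => simp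
    · subst hm
      simp [κ'']
    · match i with
      | 0 => exact ⟨biprod.snd, by simp, by ext <;> simp⟩
      | 1 => dsimp only; infer_instance
      | j + 2 => dsimp only; infer_instance

end PreSeq

/-- The kernel of a split epimorphism `A ⊞ (Y ⊞ B) ⟶ Y` which is the identity on `Y` is
`A ⊞ B`, whatever the section. -/
theorem exists_kernel_splitting {C : Type u} [Category.{v} C] [Preadditive C]
    [HasBinaryBiproducts C] {A B Y : C} (f : A ⟶ Y) (d : B ⟶ Y) (s : Y ⟶ A ⊞ (Y ⊞ B))
    (hs : s ≫ biprod.desc f (biprod.desc (𝟙 Y) d) = 𝟙 Y) :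
    ∃ (K : C) (k : K ⟶ A ⊞ (Y ⊞ B)) (q : A ⊞ (Y ⊞ B) ⟶ K), k ≫ q = 𝟙 _ ∧
      biprod.desc f (biprod.desc (𝟙 Y) d) ≫ s + q ≫ k = 𝟙 _ := by
  let p : A ⊞ (Y ⊞ B) ⟶ Y := biprod.desc f (biprod.desc (𝟙 Y) d)
  let k : A ⊞ B ⟶ A ⊞ (Y ⊞ B) :=
    biprod.desc (biprod.lift (𝟙 A) (biprod.lift (-f) 0)) (biprod.lift 0 (biprod.lift (-d) (𝟙 B)))
  let π : A ⊞ (Y ⊞ B) ⟶ A ⊞ B := biprod.map (𝟙 A) biprod.snd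
  have hkπ : k ≫ π = 𝟙 _ := by ext <;> simp [k, π]
  have hkp : k ≫ p = 0 := by ext <;> simp [k, p]
  have hπk : π ≫ k = 𝟙 _ - p ≫ biprod.inl ≫ biprod.inr := by
    ext <;> simp [k, p, π]
  have hsp : s ≫ p = 𝟙 _ := hs
  refine ⟨A ⊞ B, k, π - p ≫ s ≫ π, ?_, ?_⟩
  · rw [Preadditive.comp_sub, hkπ, reassoc_of% hkp, zero_comp, sub_zero]
  · change p ≫ s + _ = _
    rw [Preadditive.sub_comp, Category.assoc, Category.assoc, hπk]
    simp [reassoc_of% hsp]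

/-- The class of angles is invariant under homotopy equivalences that are the identity on the end
terms. If `f : X ⟶ Y` is such a homotopy equivalence, then `Y` is a direct summand of the sum of
`X` and the contractible angle on the terms of `Y`, the projection having components `f`, `1` and
`d`. -/
theorem IsAngulation.mem_of_htpyEquivalent {C : Type u} [Category.{v} C] [Preadditive C]
    [HasZeroObject C] [HasBinaryBiproducts C] {S : C ⥤ C} {n : ℕ} {box : Set (SSeq S n)}
    (hbox : IsAngulation S n box) [NeZero n] {A Z : C} (X Y : EndedComplex n A Z)
    (h : HtpyEquivalent X Y) (δ : Z ⟶ S.obj A) (hX : X.toSSeq δ ∈ box) : Y.toSSeq δ ∈ box := by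
  have := hbox.automorphism.additive
  have := hbox.automorphism.isEquivalence
  obtain ⟨e, ⟨hf0, hf1⟩, hg0, hg1⟩ := h
  have hU := (X.pre_inBox hbox δ).2 hX
  -- the components of the homotopy, reindexed
  obtain ⟨h, h0, hs⟩ : ∃ h : ∀ i, Y.K.X (i + 1) ⟶ Y.K.X i,
      e.inv.f 0 ≫ e.hom.f 0 + Y.K.d 0 1 ≫ h 0 = 𝟙 _ ∧
      ∀ i, e.inv.f (i + 1) ≫ e.hom.f (i + 1) + Y.K.d (i + 1) (i + 2) ≫ h (i + 1) +
        h i ≫ Y.K.d i (i + 1) = 𝟙 _ := by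
    have H := e.homotopyInvHomId.comm
    refine ⟨fun i => -e.homotopyInvHomId.hom (i + 1) i, ?_, fun i => ?_⟩
    · have := H 0
      rw [dNext_eq (i := 0) (i' := 1) _ rfl, prevD_eq_zero _ _ (by simp)] at this
      simp only [HomologicalComplex.comp_f, HomologicalComplex.id_f] at this
      rw [this]
      simp
    · have := H (i + 1)
      rw [dNext_eq (i := i + 1) (i' := i + 2) _ rfl, prevD_eq (j := i + 1) (j' := i) _ rfl] at this
      simp only [HomologicalComplex.comp_f, HomologicalComplex.id_f] at this
      rw [this]
      simp
      abel
  have hgf0 : e.inv.f 0 ≫ e.hom.f 0 = 𝟙 _ := by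
    rw [← cancel_mono Y.left.hom, Category.assoc, hf0, reassoc_of% hg0]; simp
  have hgf1 : e.inv.f (n + 1) ≫ e.hom.f (n + 1) = 𝟙 _ := by
    rw [← cancel_mono Y.right.hom, Category.assoc, hf1, reassoc_of% hg1]; simp
  -- the last morphisms of the two sequences
  obtain ⟨wX, hwX⟩ : ∃ w : X.K.X (n + 1) ⟶ S.obj (X.K.X 0),
    X.right.hom ≫ δ ≫ S.map X.left.inv = w := ⟨_, rfl⟩
  obtain ⟨wY, hwY⟩ : ∃ w : Y.K.X (n + 1) ⟶ S.obj (Y.K.X 0),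
    Y.right.hom ≫ δ ≫ S.map Y.left.inv = w := ⟨_, rfl⟩
  have hXwd : wX ≫ S.map (X.K.d 0 1) = 0 := hwX ▸ hU.w_map_d hbox
  have hXdw : X.K.d n (n + 1) ≫ wX = 0 := hwX ▸ hU.d_w hbox
  have hfw : wX ≫ S.map (e.hom.f 0) = e.hom.f (n + 1) ≫ wY := by
    have h1 : X.left.inv ≫ e.hom.f 0 = Y.left.inv := by
      rw [← cancel_mono Y.left.hom, Category.assoc, hf0]; simp
    rw [← hwX, ← hwY, reassoc_of% hf1]
    simp only [Category.assoc, ← S.map_comp, h1]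
  have hgw : wY ≫ S.map (e.inv.f 0) = e.inv.f (n + 1) ≫ wX := by
    have h1 : Y.left.inv ≫ e.inv.f 0 = X.left.inv := by
      rw [← cancel_mono X.left.hom, Category.assoc, hg0]; simp
    rw [← hwX, ← hwY, reassoc_of% hg1]
    simp only [Category.assoc, ← S.map_comp, h1]
  have hwd : wY ≫ S.map (Y.K.d 0 1) = 0 := by
    have := hgw =≫ S.map (e.hom.f 0)
    rw [Category.assoc, Category.assoc, ← S.map_comp, hgf0, S.map_id, Category.comp_id] at this
    rw [this, Category.assoc, Category.assoc, ← S.map_comp, e.hom.comm, S.map_comp,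
      reassoc_of% hXwd]
    simp
  have hdw : Y.K.d n (n + 1) ≫ wY = 0 := by
    have := Y.K.d n (n + 1) ≫= hgf1 =≫ wY
    rw [Category.id_comp, Category.assoc, ← hfw, ← e.inv.comm_assoc, reassoc_of% hXdw] at this
    simpa using this.symm
  obtain ⟨V, ⟨κ⟩⟩ : ∃ V, Nonempty (S.obj V ≅ Y.K.X (n + 1)) := ⟨_, ⟨S.objObjPreimageIso _⟩⟩
  obtain ⟨v, hv⟩ := S.map_surjective (κ.hom ≫ wY)
  have hP := PreSeq.contractible_inBox hbox (n + 2) le_rfl Y.K.X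
    (fun i hi => Y.isZero i (by omega)) κ
  have hW := ((PreSeq.biprodDirectSum (X.pre δ) (PreSeq.contractible Y.K.X κ)).inBox_iff hbox).2
    ⟨hU, hP⟩
  rw [← Y.pre_inBox hbox]
  refine PreSeq.InBox.of_retract hbox
    ⟨fun i => match i with
      | 0 => biprod.lift (e.inv.f 0) (biprod.lift (Y.K.d 0 1 ≫ h 0) 0)
      | i + 1 => biprod.lift (e.inv.f (i + 1)) (biprod.lift (Y.K.d (i + 1) (i + 2) ≫ h (i + 1))
          (h i)), fun i _ => ?_, ?_⟩
    ⟨fun i => match i with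
      | 0 => biprod.desc (e.hom.f 0) (biprod.desc (𝟙 _) v)
      | i + 1 => biprod.desc (e.hom.f (i + 1)) (biprod.desc (𝟙 _) (Y.K.d i (i + 1))),
      fun i _ => ?_, ?_⟩ (fun i _ => ?_) (fun i _ => ?_) hW
  · match i with
    | 0 => ext <;> simp
    | i + 1 => ext <;> simp
  · dsimp only
    rw [hwX, hwY]
    have hz : Y.K.d (n + 1) (n + 2) = 0 := (Y.isZero _ (by omega)).eq_of_tgt _ _
    rw [biprod.lift_eq, biprod.lift_eq, S.map_add]
    simp [hz, reassoc_of% hgw, reassoc_of% hwd]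
  · match i with
    | 0 =>
      have hvd : v ≫ Y.K.d 0 1 = 0 := S.map_injective (by simp [hv, hwd])
      ext <;> simp [hvd]
    | i + 1 => ext <;> simp
  · dsimp only
    rw [hwX, hwY]
    refine biprod.hom_ext' _ _ ?_ (biprod.hom_ext' _ _ ?_ ?_)
    · simp only [biprod.inl_desc_assoc, Category.assoc, ← S.map_comp, biprod.inl_desc, hfw]
    · simp only [biprod.inr_desc_assoc, biprod.inl_fst_assoc, Category.assoc, ← S.map_comp,
        biprod.inr_desc, hv, Iso.inv_hom_id_assoc, biprod.inl_desc_assoc, Category.id_comp]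
    · simp [hdw]
  · match i with
    | 0 => simp [h0]
    | i + 1 => simpa [add_assoc] using hs i
  · match i with
    | 0 => exact exists_kernel_splitting _ _ _ (by simp [h0])
    | i + 1 => exact exists_kernel_splitting _ _ _ (by simpa [add_assoc] using hs i)

/-! ### Complexes given by sequences -/

section ToEnded

variable {C : Type u} [Category.{v} C] [Preadditive C]

/-- The cochain complex with terms `X` and differentials `d`: `CochainComplex.of`, with
reducible terms. -/
abbrev complexOf (X : ℕ → C) (d : ∀ i, X i ⟶ X (i + 1)) (h : ∀ i, d i ≫ d (i + 1) = 0) :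
    CochainComplex C ℕ where
  X := X
  d := CochainComplex.of.d X d
  shape := (CochainComplex.of X d h).shape
  d_comp_d' := (CochainComplex.of X d h).d_comp_d'

variable [HasZeroObject C] {S : C ⥤ C} {n : ℕ} {box : Set (SSeq S n)}

/-- The object of `C^{n+2}_{(A,Z)}` given by a sequence with end terms `A` and `Z` in which
consecutive differentials compose to zero. -/
noncomputable abbrev PreSeq.toEnded (U : PreSeq S n) (hU : ∀ i, i < n → U.d i ≫ U.d (i + 1) = 0)
    {A Z : C} (e₀ : U.X 0 ≅ A) (e : U.X (n + 1) ≅ Z) : EndedComplex n A Z where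
  K := complexOf (cutObj (n + 1) U.X) (fun i => cutMap (n + 1) (U.d i)) fun i => by
    by_cases hi : i < n
    · rw [cutMap_comp (by omega), hU i hi, cutMap_zero]
    · exact (isZero_cutObj _ (by omega)).eq_of_tgt _ _
  isZero i hi := isZero_cutObj _ hi
  left := cutIso (m := n + 1) U.X (Nat.zero_le _) ≪≫ e₀
  right := cutIso (m := n + 1) U.X le_rfl ≪≫ e

theorem PreSeq.InBox.toEnded_mem {U : PreSeq S n} (h : U.InBox box)
    (hU : ∀ i, i < n → U.d i ≫ U.d (i + 1) = 0) {A Z : C} (e₀ : U.X 0 ≅ A) (e : U.X (n + 1) ≅ Z)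
    (δ : Z ⟶ S.obj A) (hw : U.w ≫ S.map e₀.hom = e.hom ≫ δ) :
    (U.toEnded hU e₀ e).toSSeq δ ∈ box := by
  have hw' : U.w = e.hom ≫ δ ≫ S.map e₀.inv := by
    rw [← reassoc_of% hw, ← S.map_comp, e₀.hom_inv_id, S.map_id, Category.comp_id]
  suffices (U.toEnded hU e₀ e).toSSeq δ = U.trunc from this ▸ h
  dsimp only [EndedComplex.toSSeq, PreSeq.trunc]
  congr 1
  · exact funext fun i => CochainComplex.of_d (cutObj (n + 1) U.X) _ i
  · simp [hw']

theorem PreSeq.toEnded_d (U : PreSeq S n) (hU : ∀ i, i < n → U.d i ≫ U.d (i + 1) = 0)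
    {A Z : C} (e₀ : U.X 0 ≅ A) (e : U.X (n + 1) ≅ Z) {i : ℕ} (hi : i ≤ n) :
    (U.toEnded hU e₀ e).K.d i (i + 1) ≫ cutOut (n + 1) U.X (i + 1) =
      cutOut (n + 1) U.X i ≫ U.d i := by
  rw [show (U.toEnded hU e₀ e).K.d i (i + 1) = cutMap (n + 1) (U.d i) from
    CochainComplex.of_d (cutObj (n + 1) U.X) (fun i => cutMap (n + 1) (U.d i)) i]
  simp [cutMap, cutIn_cutOut U.X (show i + 1 ≤ n + 1 by omega)]

theorem PreSeq.toEnded_dFirst (U : PreSeq S n) (hU : ∀ i, i < n → U.d i ≫ U.d (i + 1) = 0)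
    {A Z : C} (e₀ : U.X 0 ≅ A) (e : U.X (n + 1) ≅ Z) :
    (U.toEnded hU e₀ e).dFirst ≫ cutOut (n + 1) U.X 1 = e₀.inv ≫ U.d 0 := by
  have h := cutIn_cutOut U.X (Nat.zero_le (n + 1))
  rw [EndedComplex.dFirst, Category.assoc]
  refine (congrArg (_ ≫ ·) (U.toEnded_d hU e₀ e (Nat.zero_le n))).trans ?_
  simp [reassoc_of% h]

theorem PreSeq.toEnded_dLast (U : PreSeq S n) (hU : ∀ i, i < n → U.d i ≫ U.d (i + 1) = 0)
    {A Z : C} (e₀ : U.X 0 ≅ A) (e : U.X (n + 1) ≅ Z) :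
    (U.toEnded hU e₀ e).dLast = cutOut (n + 1) U.X n ≫ U.d n ≫ e.hom := by
  rw [EndedComplex.dLast, ← Category.assoc (cutOut _ _ _), ← U.toEnded_d hU e₀ e le_rfl]
  simp

end ToEnded

/-! ### Good lifts: mapping cones -/

section GoodLift

variable {C : Type u} [Category.{v} C] [Preadditive C] [HasBinaryBiproducts C] {S : C ⥤ C} {n : ℕ}

/-- The terms `X¹, X² ⊞ Y¹, X³ ⊞ Y², …` of the mapping cone. -/
noncomputable abbrev coneObj (K L : CochainComplex C ℕ) : ℕ → C
  | 0 => K.X 1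
  | i + 1 => K.X (i + 2) ⊞ L.X (i + 1)

/-- The differentials of the mapping cone. -/
noncomputable abbrev coneD {K L : CochainComplex C ℕ} (f : K ⟶ L) :
    ∀ i, coneObj K L i ⟶ coneObj K L (i + 1)
  | 0 => biprod.lift (-K.d 1 2) (f.f 1)
  | i + 1 => Biprod.ofComponents (-K.d (i + 2) (i + 3)) (f.f (i + 2)) 0 (L.d (i + 1) (i + 2))

/-- The mapping cone `X¹ ⟶ X² ⊞ Y¹ ⟶ ⋯ ⟶ Xⁿ⁺¹ ⊞ Yⁿ ⟶ Yⁿ⁺¹` of a morphism `f`. The last term is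
encoded as `Xⁿ⁺² ⊞ Yⁿ⁺¹`, where `Xⁿ⁺² = 0`. -/
noncomputable abbrev EndedComplex.cone {A Z D : C} {X : EndedComplex n A Z}
    {Y : EndedComplex n A D} (f : X.K ⟶ Y.K) : EndedComplex n (X.K.X 1) D where
  K := complexOf (coneObj X.K Y.K) (coneD f) fun i => by
    match i with
    | 0 => ext <;> simp [Biprod.ofComponents]
    | i + 1 => ext <;> simp [Biprod.ofComponents, coneD]
  isZero i hi := by
    match i with
    | i + 1 => exact (biprod_isZero_iff _ _).2 ⟨X.isZero _ (by omega), Y.isZero _ (by omega)⟩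
  left := Iso.refl _
  right :=
    { hom := biprod.snd ≫ Y.right.hom
      inv := Y.right.inv ≫ biprod.inr
      hom_inv_id := by
        ext
        · exact (X.isZero _ (by omega)).eq_of_src _ _
        · exact (X.isZero _ (by omega)).eq_of_src _ _
        · simp
        · simp }

/-- The cone data of the mapping cone. -/
noncomputable def EndedComplex.coneData [NeZero n] {A Z D : C} {X : EndedComplex n A Z}
    {Y : EndedComplex n A D} (f : X.K ⟶ Y.K) : ConeData (X := X) (Y := Y) f (cone f) where
  e i h1 _ := match i, h1 with
    | _ + 1, _ => Iso.refl _
  first := by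
    simp [dFirst]
    exact CochainComplex.of_d (coneObj X.K Y.K) (coneD f) 0
  middle i h1 hn := by
    match i, h1 with
    | i + 1, h1 => simp [coneD]
  last := by
    obtain ⟨m, rfl⟩ : ∃ m, n = m + 1 := ⟨n - 1, by have := NeZero.pos n; omega⟩
    simp [dLast, coneD]
    ext <;> simp [Biprod.ofComponents]

end GoodLift

section GoodLift

variable {C : Type u} [Category.{v} C] [Preadditive C] [HasZeroObject C] [HasBinaryBiproducts C]
  {S : C ⥤ C} {n : ℕ} {box : Set (SSeq S n)}

/-- The mapping cone `X¹ ⟶ X² ⊞ Y¹ ⟶ ⋯ ⟶ Xⁿ⁺² ⊞ Yⁿ⁺¹ ⟶ S X¹` of `f : U ⟶ U'`, with last morphism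
induced by a morphism `φ`, usually an inverse of `f⁰`. -/
noncomputable abbrev PreSeq.cone {U U' : PreSeq S n} (f : PreSeq.Hom U U') (φ : U'.X 0 ⟶ U.X 0) :
    PreSeq S n where
  X i := match i with
    | 0 => U.X 1
    | i + 1 => U.X (i + 2) ⊞ U'.X (i + 1)
  d i := match i with
    | 0 => biprod.lift (-U.d 1) (f.f 1)
    | i + 1 => Biprod.ofComponents (-U.d (i + 2)) (f.f (i + 2)) 0 (U'.d (i + 1))
  w := biprod.snd ≫ U'.w ≫ S.map φ ≫ S.map (U.d 0)

/-- The mapping cone of `f : U ⟶ U'`, where `φ` is inverse to `f⁰`, is an angle if the rotated cone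
of `f` is: its right rotation arises from the rotated cone by discarding the contractible summand
on which `f⁰` is an isomorphism. -/
theorem IsAngulation.inBox_cone (hbox : IsAngulation S n box) [NeZero n] {U U' : PreSeq S n}
    (hU : U.InBox box) (hU' : U'.InBox box) (h0 : IsZero (U.X (n + 2))) (f : PreSeq.Hom U U')
    (φ : U'.X 0 ⟶ U.X 0) (h1 : f.f 0 ≫ φ = 𝟙 _) (h2 : φ ≫ f.f 0 = 𝟙 _) {V : C}
    (v : V ⟶ U'.X 0) (κ : S.obj V ≅ U'.X (n + 1)) (hv : S.map v = (-1 : ℤ) ^ n • κ.hom ≫ U'.w)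
    (hf : (PreSeq.rotCone f v κ).InBox box) : (PreSeq.cone f φ).InBox box := by
  have := hbox.automorphism.additive
  obtain ⟨m, rfl⟩ : ∃ m, n = m + 1 := ⟨n - 1, by have := NeZero.pos n; omega⟩
  have hdd := hU.d_d hbox (Nat.succ_pos m)
  have hdw := hU'.d_w hbox
  have hcomm := f.comm 0 (Nat.zero_le _)
  have hcw := f.comm_w
  let κM : S.obj V ≅ U.X (m + 3) ⊞ U'.X (m + 2) :=
    { hom := κ.hom ≫ biprod.inr
      inv := biprod.snd ≫ κ.inv
      inv_hom_id := by
        ext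
        · exact h0.eq_of_src _ _
        · exact h0.eq_of_src _ _
        · simp
        · simp }
  refine (PreSeq.inBox_rightRot hbox _ (v ≫ φ ≫ U.d 0) κM ?_).1 ?_
  · simp [κM, hv]
  -- the section corrects the inclusion of `V` so that the component `X⁰ ⊞ V ⟶ Y⁰` of the first
  -- differential of the rotated cone vanishes on it
  refine PreSeq.InBox.of_retract hbox (W := PreSeq.rotCone f v κ)
    ⟨fun i => match i with
      | 0 => biprod.lift (-(v ≫ φ)) (𝟙 _)
      | 1 => biprod.inl
      | _ + 2 => 𝟙 _, fun i hi => ?_, ?_⟩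
    ⟨fun i => match i with
      | 0 => biprod.snd
      | 1 => biprod.desc (𝟙 _) (φ ≫ U.d 0)
      | _ + 2 => 𝟙 _, fun i hi => ?_, ?_⟩ (fun i hi => ?_) (fun i hi => ?_) hf
  · match i with
    | 0 => ext <;> simp [Biprod.ofComponents, h2]
    | 1 => ext <;> simp [Biprod.ofComponents]
    | _ + 2 => simp
  · have hv' : κ.inv ≫ S.map v = (-1 : ℤ) ^ (m + 1) • U'.w := by simp [hv]
    have h1' : S.map (f.f 0) ≫ S.map φ = 𝟙 _ := by rw [← S.map_comp, h1, S.map_id]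
    ext
    · simp [κM, biprod.lift_eq, Biprod.ofComponents, reassoc_of% hv', ← reassoc_of% hcw,
        reassoc_of% h1', pow_succ]
    · simp [κM, biprod.lift_eq, Biprod.ofComponents, reassoc_of% hv', reassoc_of% hdw]
  · match i with
    | 0 => ext <;> simp [Biprod.ofComponents, reassoc_of% h1]
    | 1 => ext <;> simp [Biprod.ofComponents, hdd, hcomm, reassoc_of% h2]
    | _ + 2 => simp
  · dsimp only
    ext <;> simp [κM, Biprod.ofComponents, ← S.map_comp]
  · match i with
    | 0 => simp
    | 1 => simp
    | _ + 2 => simp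
  · match i with
    | 0 =>
      refine ⟨U.X 0, biprod.inl, biprod.desc (𝟙 _) (v ≫ φ), by simp, ?_⟩
      ext <;> simp
    | 1 =>
      refine ⟨U'.X 0, biprod.lift (-(φ ≫ U.d 0)) (𝟙 _), biprod.snd, by simp, ?_⟩
      ext <;> simp
    | _ + 2 => exact ⟨0, 0, 0, (isZero_zero C).eq_of_src _ _, by simp⟩

/-- Good lifts: every morphism `(1, c)` of extensions has a lift whose mapping cone is an angle. -/
theorem IsAngulation.exists_good_lift (hbox : IsAngulation S n box) [NeZero n] {A Z D : C}
    {X : EndedComplex n A Z} {Y : EndedComplex n A D} (c : Z ⟶ D) (ρ : D ⟶ S.obj A)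
    (hX : X.toSSeq (c ≫ ρ) ∈ box) (hY : Y.toSSeq ρ ∈ box) :
    ∃ f : X.K ⟶ Y.K, HasEnds (X := X) (Y := Y) f (𝟙 A) c ∧
      (EndedComplex.cone f).toSSeq (ρ ≫ S.map X.dFirst) ∈ box := by
  obtain ⟨f, hf, hw, V, v, κ, hv, hc⟩ := hbox.exists_lift hX hY (𝟙 A) c (by simp)
  refine ⟨f, hf, (EndedComplex.pre_inBox hbox _ _).1 ?_⟩
  have h0 : f.f 0 ≫ Y.left.hom = X.left.hom := by simpa using hf.1
  have := hbox.inBox_cone ((X.pre_inBox hbox _).2 hX) ((Y.pre_inBox hbox _).2 hY)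
    (X.isZero _ (by omega)) (preHom f hw) (Y.left.hom ≫ X.left.inv) ?_ ?_ v κ hv hc
  · convert this using 1
    dsimp only [EndedComplex.pre, PreSeq.cone]
    congr 1
    · funext i
      refine (CochainComplex.of_d _ _ i).trans ?_
      cases i <;> rfl
    · simp [EndedComplex.dFirst]
  · simp [reassoc_of% h0]
  · simp [← cancel_mono Y.left.hom, h0]

end GoodLift

/-! ### Good lifts: mapping cocones -/

section Cocone

variable {C : Type u} [Category.{v} C] [Preadditive C] [HasZeroObject C] [HasBinaryBiproducts C]
  {S : C ⥤ C} {n : ℕ} {box : Set (SSeq S n)}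

/-- The mapping cocone `X⁰ ⟶ X¹ ⊞ Y⁰ ⟶ ⋯ ⟶ Xⁿ ⊞ Yⁿ⁻¹ ⟶ Yⁿ ⟶ S X⁰` of `f : U ⟶ U'`, with last
morphism induced by a morphism `g`, usually an inverse of `fⁿ⁺¹`. The differentials have the signs
of the rotated cone; the term `Yⁿ` is encoded as `0 ⊞ Yⁿ`. -/
noncomputable abbrev PreSeq.cocone {U U' : PreSeq S n} (f : PreSeq.Hom U U')
    (g : U'.X (n + 1) ⟶ U.X (n + 1)) : PreSeq S n where
  X i := match i with
    | 0 => U.X 0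
    | i + 1 => cutObj n U.X (i + 1) ⊞ U'.X i
  d i := match i with
    | 0 => biprod.lift (-(U.d 0 ≫ cutIn n U.X 1)) (f.f 0)
    | i + 1 => Biprod.ofComponents (-(cutOut n U.X (i + 1) ≫ U.d (i + 1) ≫ cutIn n U.X (i + 2)))
        (cutOut n U.X (i + 1) ≫ f.f (i + 1)) 0 (U'.d i)
  w := biprod.snd ≫ ((-1 : ℤ) ^ n • (U'.d n ≫ g ≫ U.w))

theorem PreSeq.cocone_d_d {U U' : PreSeq S n} (hU : ∀ i, i < n → U.d i ≫ U.d (i + 1) = 0)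
    (hU' : ∀ i, i < n → U'.d i ≫ U'.d (i + 1) = 0) (f : PreSeq.Hom U U')
    (g : U'.X (n + 1) ⟶ U.X (n + 1)) (i : ℕ) (hi : i < n) :
    (cocone f g).d i ≫ (cocone f g).d (i + 1) = 0 := by
  have o {j : ℕ} (hj : j ≤ n) := cutIn_cutOut U.X hj
  match i with
  | 0 =>
    have h1 := hU 0 hi
    have h2 := f.comm 0 (Nat.zero_le _)
    ext <;> simp [Biprod.ofComponents, reassoc_of% (o (j := 1) hi), reassoc_of% h1, h2]
  | i + 1 =>
    have h1 := hU (i + 1) hi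
    have h2 := f.comm (i + 1) hi.le
    have h3 := hU' i (by omega)
    ext <;> simp [Biprod.ofComponents, reassoc_of% (o (j := i + 2) hi), reassoc_of% h1, h2, h3]

/-- The mapping cocone of `f : U ⟶ U'`, where `g` is inverse to `fⁿ⁺¹`, is an angle if the rotated
cone of `f` is: it arises by discarding the contractible summand on which `fⁿ⁺¹` is an
isomorphism. -/
theorem IsAngulation.inBox_cocone (hbox : IsAngulation S n box) [NeZero n] {U U' : PreSeq S n}
    (hU : U.InBox box) (hU' : U'.InBox box) (f : PreSeq.Hom U U')
    (g : U'.X (n + 1) ⟶ U.X (n + 1)) (h1 : f.f (n + 1) ≫ g = 𝟙 _) (h2 : g ≫ f.f (n + 1) = 𝟙 _)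
    {V : C} (v : V ⟶ U'.X 0) (κ : S.obj V ≅ U'.X (n + 1))
    (hv : S.map v = (-1 : ℤ) ^ n • κ.hom ≫ U'.w) (hf : (PreSeq.rotCone f v κ).InBox box) :
    (PreSeq.cocone f g).InBox box := by
  have := hbox.automorphism.additive
  have := hbox.automorphism.isEquivalence
  have hn : 0 < n := NeZero.pos n
  have o {j : ℕ} (hj : j ≤ n) := cutIn_cutOut U.X hj
  have oz : cutIn n U.X (n + 1) = 0 := (isZero_cutObj U.X (Nat.lt_succ_self n)).eq_of_tgt _ _
  have hcw := f.comm_w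
  obtain ⟨G, hG, hGn⟩ : ∃ G : ∀ j, U'.X j ⟶ U.X j, (∀ j, j ≤ n → G j = 0) ∧ G (n + 1) = g :=
    ⟨Function.update (fun _ => 0) (n + 1) g, fun j hj => Function.update_of_ne (by omega) _ _,
      Function.update_self _ _ _⟩
  -- the lift of `v` along `f⁰`
  obtain ⟨u, hu⟩ := S.map_surjective ((-1 : ℤ) ^ n • (κ.hom ≫ g ≫ U.w))
  have huf : u ≫ f.f 0 = v := S.map_injective (by
    simp [hu, hv, hcw, reassoc_of% h2])
  have hud : u ≫ U.d 0 = 0 := S.map_injective (by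
    simp [hu, hU.w_map_d hbox])
  have hu' : κ.inv ≫ S.map u = (-1 : ℤ) ^ n • (g ≫ U.w) := by simp [hu]
  -- `G` is `g` in degree `n + 1` and zero elsewhere, so the section corrects the inclusion in the
  -- last degree only; dually, the retraction corrects the projection in degree `0` by `u`
  refine PreSeq.InBox.of_retract hbox (W := PreSeq.rotCone f v κ)
    ⟨fun i => match i with
      | 0 => biprod.inl
      | i + 1 => Biprod.ofComponents (cutOut n U.X (i + 1)) 0 (-(U'.d i ≫ G (i + 1))) (𝟙 _),
      fun i hi => ?_, ?_⟩
    ⟨fun i => match i with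
      | 0 => biprod.desc (𝟙 _) u
      | i + 1 => biprod.map (cutIn n U.X (i + 1)) (𝟙 _), fun i hi => ?_, ?_⟩
    (fun i hi => ?_) (fun i hi => ?_) hf
  · match i with
    | 0 => ext <;> simp [Biprod.ofComponents, o (j := 1) hn, hG 1 hn]
    | i + 1 =>
      have hdd := hU'.d_d hbox hi
      have hc := f.comm (i + 1) hi
      obtain hi' | rfl := Nat.lt_or_eq_of_le hi
      · ext <;> simp [Biprod.ofComponents, o (j := i + 2) hi', hG (i + 2) hi', hG (i + 1) hi]
      · ext <;> simp [Biprod.ofComponents, oz, hGn, hG (i + 1) hi, ← reassoc_of% hc, h1,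
          reassoc_of% hdd]
  · ext
    · exact (isZero_cutObj U.X (Nat.lt_succ_self n)).eq_of_src _ _
    · simp [Biprod.ofComponents, hGn, reassoc_of% h2, pow_succ]
  · match i with
    | 0 => ext <;> simp [Biprod.ofComponents, huf, reassoc_of% hud]
    | i + 1 => ext <;> simp [Biprod.ofComponents, reassoc_of% (o (j := i + 1) hi)]
  · have h3 : S.map biprod.inl ≫ S.map (biprod.desc (𝟙 _) u) = 𝟙 _ := by
      rw [← S.map_comp, biprod.inl_desc, S.map_id]
    have h4 : S.map biprod.inr ≫ S.map (biprod.desc (𝟙 (U.X 0)) u) = S.map u := by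
      rw [← S.map_comp, biprod.inr_desc]
    refine biprod.hom_ext' _ _ ?_ ?_
    · simp [h3, h4, hu', oz, reassoc_of% h1, pow_succ]
    · simp [h4, hu']
  · match i with
    | 0 => simp
    | i + 1 =>
      dsimp only
      obtain hi' | hi' := Nat.lt_or_eq_of_le hi
      · ext <;> simp [Biprod.ofComponents, hG (i + 1) (by omega)]
      · obtain rfl : i = n := by omega
        have hz := (isZero_cutObj U.X (Nat.lt_succ_self i)).eq_of_src (𝟙 _) 0
        ext <;> simp [Biprod.ofComponents, oz, hz]
  · match i with
    | 0 =>
      refine ⟨V, biprod.lift (-u) (𝟙 _), biprod.snd, by simp, ?_⟩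
      ext <;> simp
    | i + 1 =>
      dsimp only
      obtain hi' | hi' := Nat.lt_or_eq_of_le hi
      · refine ⟨0, 0, 0, (isZero_zero C).eq_of_src _ _, ?_⟩
        have := o (j := i + 1) (by omega)
        ext <;> simp [Biprod.ofComponents, hG (i + 1) (by omega), this]
      · obtain rfl : i = n := by omega
        refine ⟨U.X (i + 1), biprod.inl, biprod.desc (𝟙 _) (U'.d i ≫ G (i + 1)), by simp, ?_⟩
        ext <;> simp [Biprod.ofComponents, oz]

/-- Multiplication by `(-1) ^ j`, as an isomorphism. -/
abbrev signIso (j : ℕ) (A : C) : A ≅ A where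
  hom := (-1 : ℤ) ^ j • 𝟙 A
  inv := (-1 : ℤ) ^ j • 𝟙 A
  hom_inv_id := by simp [smul_smul, ← mul_pow]
  inv_hom_id := by simp [smul_smul, ← mul_pow]

/-- The identification of the last term `0 ⊞ Yⁿ` of the mapping cocone with `Yⁿ`, with the sign
required by the sign conventions of `CoconeData`. -/
noncomputable abbrev PreSeq.coconeRight {U U' : PreSeq S n} (f : PreSeq.Hom U U')
    (g : U'.X (n + 1) ⟶ U.X (n + 1)) : (cocone f g).X (n + 1) ≅ U'.X n where
  hom := (-1 : ℤ) ^ n • biprod.snd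
  inv := (-1 : ℤ) ^ n • biprod.inr
  hom_inv_id := by
    refine biprod.hom_ext' _ _ ((isZero_cutObj U.X (Nat.lt_succ_self n)).eq_of_src _ _) ?_
    simp [smul_smul, ← mul_pow]
  inv_hom_id := by simp [smul_smul, ← mul_pow]

/-- Good lifts, dually: every morphism `(a, 1)` of extensions has a lift whose mapping cocone is an
angle. The signs of the rotated cone differ from those of `CoconeData` by an isomorphism. -/
theorem IsAngulation.exists_good_lift_op (hbox : IsAngulation S n box) [NeZero n] {A B Z : C}
    {X : EndedComplex n A Z} {Y : EndedComplex n B Z} (a : A ⟶ B) (ρ : Z ⟶ S.obj A)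
    (hX : X.toSSeq ρ ∈ box) (hY : Y.toSSeq (ρ ≫ S.map a) ∈ box) :
    ∃ h : X.K ⟶ Y.K, HasEnds (X := X) (Y := Y) h a (𝟙 Z) ∧
      ∃ N : EndedComplex n A (Y.K.X n),
        Nonempty (CoconeData (X := X) (Y := Y) h N) ∧ N.toSSeq (Y.dLast ≫ ρ) ∈ box := by
  obtain ⟨f, hf, hw, V, v, κ, hv, hc⟩ := hbox.exists_lift hX hY a (𝟙 Z) (by simp)
  have h0 : f.f (n + 1) ≫ Y.right.hom = X.right.hom := by simpa using hf.2
  have hU := (X.pre_inBox hbox _).2 hX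
  have hU' := (Y.pre_inBox hbox _).2 hY
  have hN := hbox.inBox_cocone hU hU' (preHom f hw) (Y.right.hom ≫ X.right.inv)
    (by simp [reassoc_of% h0]) (by simp [← cancel_mono Y.right.hom, h0]) v κ hv hc
  have hdd := PreSeq.cocone_d_d (fun i _ => X.K.d_comp_d _ _ _) (fun i _ => Y.K.d_comp_d _ _ _)
    (preHom f hw) (Y.right.hom ≫ X.right.inv)
  refine ⟨f, hf, PreSeq.toEnded _ hdd X.left (PreSeq.coconeRight _ _), ⟨?_⟩,
    hN.toEnded_mem hdd _ _ _ ?_⟩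
  · exact
      { e := fun i j hij hj => match j, hij with
          | _, rfl => cutIso (PreSeq.cocone (preHom f hw) (Y.right.hom ≫ X.right.inv)).X
                (i := i + 1) (m := n + 1) (by omega) ≪≫
              biprod.mapIso (cutIso X.K.X hj ≪≫ signIso (i + 1) _) (signIso i _)
        first := by
          refine (Category.assoc _ _ _).symm.trans ?_
          refine (congrArg (· ≫ _) (PreSeq.toEnded_dFirst _ hdd X.left _)).trans ?_
          have := cutIn_cutOut X.K.X (NeZero.pos n : 1 ≤ n)
          ext <;> simp [EndedComplex.dFirst, this]
        middle := by
          rintro i _ _ rfl rfl hk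
          refine (Category.assoc _ _ _).symm.trans ?_
          refine (congrArg (· ≫ _) (PreSeq.toEnded_d _ hdd X.left _ (by omega))).trans ?_
          refine (Category.assoc _ _ _).trans ((congrArg (_ ≫ ·) ?_).trans
            (Category.assoc _ _ _).symm)
          have := cutIn_cutOut X.K.X hk
          ext <;> simp [Biprod.ofComponents, pow_succ, this]
        last := by
          rintro i rfl
          refine (PreSeq.toEnded_dLast _ hdd X.left _).trans ?_
          refine (congrArg (_ ≫ ·) ?_).trans (Category.assoc _ _ _).symm
          ext <;> simp [Biprod.ofComponents, pow_succ] }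
  · simp [EndedComplex.dLast]

end Cocone

/-! ### The realization defined by the angles -/

section Main

variable {C : Type u} [Category.{v} C] [Preadditive C]

theorem isBiadditive_ESigma (S : C ⥤ C) [S.Additive] : IsBiadditive (ESigma S) := by
  refine ⟨fun Z => ⟨fun {A B f g} => ?_⟩, fun A => ⟨fun {Z Z' f g} => ?_⟩⟩
  · ext (δ : Z.unop ⟶ S.obj A)
    change δ ≫ S.map (f + g) = δ ≫ S.map f + δ ≫ S.map g
    simp
  · ext (δ : Z.unop ⟶ S.obj A)
    change (f + g).unop ≫ δ = f.unop ≫ δ + g.unop ≫ δ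
    simp

variable [HasZeroObject C] [HasBinaryBiproducts C] {S : C ⥤ C} {n : ℕ} [NeZero n]
  {box : Set (SSeq S n)}

/-- Every extension is the last morphism of an angle with the given end terms. -/
theorem IsAngulation.exists_toSSeq_mem (hbox : IsAngulation S n box) {Z A : C}
    (δ : Z ⟶ S.obj A) : ∃ X : EndedComplex n A Z, X.toSSeq δ ∈ box := by
  obtain ⟨U, hU, e₀, e, h⟩ := PreSeq.exists_inBox_w hbox δ
  exact ⟨_, hU.toEnded_mem (fun _ hi => hU.d_d hbox hi) e₀ e δ h⟩

/-- The class of the angles with last morphism `δ`. -/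
noncomputable def IsAngulation.realization (hbox : IsAngulation S n box) :
    Correspondence (ESigma S) n :=
  fun _ _ δ => (hbox.exists_toSSeq_mem δ).choose.cls

theorem IsAngulation.realizes_iff (hbox : IsAngulation S n box) {A Z : C}
    (X : EndedComplex n A Z) (δ : Z ⟶ S.obj A) :
    Realizes (E := ESigma S) hbox.realization X δ ↔ X.toSSeq δ ∈ box := by
  have h := (hbox.exists_toSSeq_mem δ).choose_spec
  exact ⟨fun hX => hbox.mem_of_htpyEquivalent _ _ (Quotient.exact hX) δ h,
    fun hX => Quotient.sound (hbox.htpyEquivalent _ _ δ h hX)⟩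

theorem IsAngulation.isDistinguished_iff (hbox : IsAngulation S n box) {A Z : C}
    (X : EndedComplex n A Z) (δ : Z ⟶ S.obj A) :
    IsDistinguished (E := ESigma S) hbox.realization X δ ↔ X.toSSeq δ ∈ box :=
  ⟨fun h => (hbox.realizes_iff X δ).1 h.2,
    fun h => ⟨hbox.isNExangle X δ h, (hbox.realizes_iff X δ).2 h⟩⟩

/-- Every morphism is an inflation. -/
theorem IsAngulation.isInflation (hbox : IsAngulation S n box) {A B : C} (f : A ⟶ B) :
    IsInflation hbox.realization f := by
  obtain ⟨U, hU, e₀, e₁, h⟩ := PreSeq.exists_inBox_d hbox f 0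
  have hdd : ∀ i, i < n → U.d i ≫ U.d (i + 1) = 0 := fun _ hi => hU.d_d hbox hi
  refine ⟨_, U.w ≫ S.map e₀.hom, U.toEnded hdd e₀ (Iso.refl _),
    cutIso (m := n + 1) U.X (i := 1) (by omega) ≪≫ e₁,
    (hbox.realizes_iff _ _).2 (hU.toEnded_mem hdd _ _ _ (by simp)), ?_⟩
  refine (Category.assoc _ _ _).symm.trans ?_
  refine (congrArg (· ≫ _) (U.toEnded_dFirst hdd e₀ _)).trans ?_
  simp [h]

/-- Every morphism is a deflation. -/
theorem IsAngulation.isDeflation (hbox : IsAngulation S n box) {B Z : C} (g : B ⟶ Z) :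
    IsDeflation hbox.realization g := by
  obtain ⟨U, hU, e, e', h⟩ := PreSeq.exists_inBox_d hbox g n
  have hdd : ∀ i, i < n → U.d i ≫ U.d (i + 1) = 0 := fun _ hi => hU.d_d hbox hi
  refine ⟨_, e'.inv ≫ U.w, U.toEnded hdd (Iso.refl _) e',
    cutIso (m := n + 1) U.X (by omega) ≪≫ e,
    (hbox.realizes_iff _ _).2 (hU.toEnded_mem hdd _ _ _ (by simp)), ?_⟩
  refine (congrArg (_ ≫ ·) (U.toEnded_dLast hdd _ e')).trans ?_
  have := cutIn_cutOut U.X (show n ≤ n + 1 by omega)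
  simp [h, reassoc_of% this]

theorem IsAngulation.isExactRealization (hbox : IsAngulation S n box) :
    IsExactRealization (ESigma S) n hbox.realization where
  lift X Y δ ρ hX hY a c h := by
    obtain ⟨f, hf, -⟩ := hbox.exists_lift ((hbox.realizes_iff X δ).1 hX)
      ((hbox.realizes_iff Y ρ).1 hY) a c h
    exact ⟨f, hf⟩
  exangle X δ hX := hbox.isNExangle X δ ((hbox.realizes_iff X δ).1 hX)
  zero_left A := (hbox.realizes_iff _ _).2 (hbox.trivLeft_mem A _)
  zero_right A := (hbox.realizes_iff _ _).2 (hbox.trivRight_mem A _)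

theorem IsAngulation.isNExangulated (hbox : IsAngulation S n box) :
    IsNExangulated (ESigma S) n hbox.realization where
  biadditive := by
    have := hbox.automorphism.additive
    exact isBiadditive_ESigma S
  exactRealization := hbox.isExactRealization
  inflation_comp f g _ _ := hbox.isInflation (f ≫ g)
  deflation_comp f g _ _ := hbox.isDeflation (f ≫ g)
  good_lift c ρ X Y hX hY := by
    obtain ⟨f, hf, hM⟩ := hbox.exists_good_lift c ρ ((hbox.isDistinguished_iff _ _).1 hX)
      ((hbox.isDistinguished_iff _ _).1 hY)
    exact ⟨f, hf, _, ⟨EndedComplex.coneData f⟩, (hbox.isDistinguished_iff _ _).2 hM⟩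
  good_lift_op a ρ X Y hX hY := by
    obtain ⟨f, hf, N, hN, hN'⟩ := hbox.exists_good_lift_op a ρ
      ((hbox.isDistinguished_iff _ _).1 hX) ((hbox.isDistinguished_iff _ _).1 hY)
    exact ⟨f, hf, N, hN, (hbox.isDistinguished_iff _ _).2 hN'⟩

end Main

end NExangulated

theorem mainTheorem3 {C : Type u} [Category.{v} C] [Preadditive C] [HasZeroObject C]
    [HasBinaryBiproducts C] (n : ℕ) [NeZero n] (S : C ⥤ C)
    (box : Set (NExangulated.SSeq S n)) (hbox : NExangulated.IsAngulation S n box) :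
    ∃ s : NExangulated.Correspondence (NExangulated.ESigma S) n,
      (∀ (Z A : C) (δ : Z ⟶ S.obj A),
        (∃ X : NExangulated.EndedComplex n A Z, X.toSSeq δ ∈ box) ∧
        ∀ X : NExangulated.EndedComplex n A Z, X.toSSeq δ ∈ box → s Z A δ = X.cls) ∧
      NExangulated.IsExactRealization (NExangulated.ESigma S) n s ∧
      NExangulated.IsNExangulated (NExangulated.ESigma S) n s :=
  ⟨hbox.realization, fun _ _ δ => ⟨hbox.exists_toSSeq_mem δ,
    fun X hX => (hbox.realizes_iff X δ).2 hX⟩, hbox.isExactRealization, hbox.isNExangulated⟩
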